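/- **Theorem 1.2 (kinetic Gagliardo–Nirenberg inequality).** Let $d\ge 1$ be an integer and write points of $\mathbb R^{1+2d}$ as $(t,x,v)$ with $t\in\mathbb R$ and $x,v\in\mathbb R^d$. Let $p,\mu\in(1,\infty)$ and let $q\in(\max\{2,p,\mu\},\infty)$ satisfy $$\frac1q=\frac1{4d+2}\left(\frac{3d+1}{p}+\frac{d+1}{\mu}-1\right).$$ Then there exists a constant $C=C(d,p,\mu)>0$ such that the following holds. Let $f\in L^2(\mathbb R^{1+2d})$ be a real-valued function whose distributional velocity gradient $\nabla_v f$ belongs to $L^p(\mathbb R^{1+2d};\mathbb R^d)$, and suppose that $$(\partial_t+v\cdot\nabla_x)f=\nabla_v\cdot S_0$$ in the sense of distributions on $\mathbb R^{1+2d}$ for some $S_0\in L^\mu(\mathbb R^{1+2d};\mathbb R^d)$. Then $$\|f\|_{L^q(\mathbb R^{1+2d})}\le C\,\|\nabla_v f\|_{L^p(\mathbb R^{1+2d})}^{\frac{3d+1}{4d+2}}\,\|S_0\|_{L^\mu(\mathbb R^{1+2d})}^{\frac{d+1}{4d+2}}.$$ (In particular $f\in L^q(\mathbb R^{1+2d})$.)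 -/

import Mathlib

open MeasureTheory
open scoped ContDiff ENNReal

/-- The position and velocity space `ℝ^d` with its Euclidean norm and Lebesgue measure. -/
abbrev Rd (d : ℕ) : Type := EuclideanSpace ℝ (Fin d)

/-- The space `ℝ^{1+2d}` of points `(t, x, v)`; `volume` on it is Lebesgue measure. -/
abbrev KineticSpace (d : ℕ) : Type := ℝ × Rd d × Rd d

/-- Test functions: real-valued, infinitely differentiable, with compact support. -/
def IsTestFunction {d : ℕ} (φ : KineticSpace d → ℝ) : Prop :=
  ContDiff ℝ ∞ φ ∧ HasCompactSupport φ

/-- The partial derivative `∂_{v_i} φ`. -/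
noncomputable def partialV {d : ℕ} (i : Fin d) (φ : KineticSpace d → ℝ) (z : KineticSpace d) : ℝ :=
  fderiv ℝ φ z (0, 0, EuclideanSpace.single i 1)

/-- The transport derivative `(∂_t + v · ∇_x) φ` at `z = (t, x, v)`, that is, the derivative
of `φ` at `z` in the direction `(1, v, 0)`. -/
noncomputable def transport {d : ℕ} (φ : KineticSpace d → ℝ) (z : KineticSpace d) : ℝ :=
  fderiv ℝ φ z (1, z.2.2, 0)

/-- `∇_v f = G` in the sense of distributions on `ℝ^{1+2d}`, for locally integrable `f`, `G`:
`∫ f ∂_{v_i} φ = - ∫ G_i φ` for every `i` and every test function `φ`. -/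
def HasWeakGradV {d : ℕ} (f : KineticSpace d → ℝ) (G : KineticSpace d → Rd d) : Prop :=
  LocallyIntegrable f ∧ LocallyIntegrable G ∧
    ∀ φ : KineticSpace d → ℝ, IsTestFunction φ → ∀ i : Fin d,
      ∫ z, f z * partialV i φ z = -∫ z, G z i * φ z

/-- `(∂_t + v · ∇_x) f = ∇_v · S` in the sense of distributions on `ℝ^{1+2d}`, for locally
integrable `f`, `S`: testing with `φ` and moving all derivatives to `φ` (the coefficient `v` does
not depend on `x`) gives `-∫ f (∂_t + v · ∇_x) φ = -∫ S · ∇_v φ`. -/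
def IsKineticSolution {d : ℕ} (f : KineticSpace d → ℝ) (S : KineticSpace d → Rd d) : Prop :=
  LocallyIntegrable f ∧ LocallyIntegrable S ∧
    ∀ φ : KineticSpace d → ℝ, IsTestFunction φ →
      -∫ z, f z * transport φ z = -∫ z, ∑ i : Fin d, S z i * partialV i φ z

/-!
The transport operator `∂_t + v · ∇_x` and the gradient `∇_v` commute with the left translations of
the Galilean group (`gmul`) and are homogeneous under the dilations
`δ_{a,b} (t, x, v) = (a t, a b x, b v)` with two independent parameters. Fix a smooth compactly
supported `K` with integral one and average `f` over the image of `K` under `w ↦ z ∘ δ_{a,b} w`,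
along the curve `a = c ^ (2 d) exp τ`, `b = c ^ (-(d + 1)) exp (κ τ)` of scales, on which the
Jacobian is `exp (N τ)` with `N = 1 + d + 2 d κ`.

The `τ`-derivative of the average is again an average of `f`, with weight
`dilGen κ K = -(N K + E K)` for the Euler field `E` of the dilations. Since
`∂_{x_i} = [∂_{v_i}, ∂_t + v · ∇_x]`, this weight is the sum of a velocity divergence and a
transport derivative of smooth compactly supported functions (`dilGen_eq`). So the derivative is an
average of `∇_v f` with factor `b` plus an average of `S₀` with factor `a / b` (`avg_dilGen`). The
averages vanish as `τ → ∞` because `f ∈ L^2`, and they converge to `f` as `τ → -∞`. Hence `|f|` is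
bounded by a potential of order `κ` of `|∇_v f|` plus a potential of order `1 - κ` of `|S₀|`
(`lintegral_enorm_mul_le`).

These potentials map `L^p` and `L^μ` to `L^q` when `κ / N = 1 / p - 1 / q` and
`(1 - κ) / N = 1 / μ - 1 / q`. Both equations have the solution `κ = δ / (δ + δ')`, with `δ` and
`δ'` the two right-hand sides: the relation between `p`, `μ` and `q` says precisely that then
`N = 1 / (δ + δ')`, and `q > max p μ` that `0 < κ < 1`. The Hardy–Littlewood–Sobolev inequality
`exists_hardyLittlewoodSobolev` is proved in trilinear form and without a maximal function: the form
is split according to which of `h ^ p`, `k ^ s` is larger, and in each half the larger factor is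
frozen. Pairing with the truncations of `|f| ^ (q - 1)` yields a sum of two terms that scale as
`c ^ (-(d + 1))` and `c ^ (3 d + 1)`, and the choice of `c` that balances them gives the product.
-/


namespace Kinetic

/-! ### The Galilean group and its Haar measure -/

variable {d : ℕ}

/-- The Galilean group law on `ℝ^{1+2d}`. Left translations `u ↦ gmul z u` commute with
`∂_t + v · ∇_x` and with `∇_v`. -/
def gmul (z u : KineticSpace d) : KineticSpace d :=
  (z.1 + u.1, z.2.1 + u.2.1 + u.1 • z.2.2, z.2.2 + u.2.2)

/-- The inverse for the Galilean group law. -/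
def ginv (u : KineticSpace d) : KineticSpace d :=
  (-u.1, -u.2.1 + u.1 • u.2.2, -u.2.2)

/-- The two-parameter dilation that scales time by `a`, velocity by `b` and position by `a * b`. -/
def dil (a b : ℝ) (w : KineticSpace d) : KineticSpace d :=
  (a * w.1, (a * b) • w.2.1, b • w.2.2)

@[fun_prop]
lemma continuous_gmul : Continuous (fun p : KineticSpace d × KineticSpace d => gmul p.1 p.2) := by
  unfold gmul; fun_prop

@[fun_prop]
lemma continuous_ginv : Continuous (ginv (d := d)) := by
  unfold ginv; fun_prop

lemma gmul_ginv_cancel (z u : KineticSpace d) : gmul (gmul z u) (ginv u) = z := by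
  rcases z with ⟨t, x, v⟩; rcases u with ⟨s, y, w⟩
  simp only [gmul, ginv, Prod.mk.injEq]
  refine ⟨by ring, by module, by module⟩

lemma gmul_left_cancel (z u : KineticSpace d) : gmul (ginv z) (gmul z u) = u := by
  rcases z with ⟨t, x, v⟩; rcases u with ⟨s, y, w⟩
  simp only [gmul, ginv, Prod.mk.injEq]
  refine ⟨by ring, by module, by module⟩

lemma gmul_left_cancel' (z u : KineticSpace d) : gmul z (gmul (ginv z) u) = u := by
  rcases z with ⟨t, x, v⟩; rcases u with ⟨s, y, w⟩
  simp only [gmul, ginv, Prod.mk.injEq]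
  refine ⟨by ring, by module, by module⟩

lemma gmul_zero (z : KineticSpace d) : gmul z 0 = z := by
  simp [gmul]

lemma dil_dil_inv {a b : ℝ} (ha : a ≠ 0) (hb : b ≠ 0) (w : KineticSpace d) :
    dil a b (dil a⁻¹ b⁻¹ w) = w := by
  rcases w with ⟨t, x, v⟩
  simp only [dil, Prod.mk.injEq, smul_smul]
  refine ⟨by field_simp, ?_, ?_⟩
  · rw [show a * b * (a⁻¹ * b⁻¹) = 1 by field_simp, one_smul]
  · rw [mul_inv_cancel₀ hb, one_smul]

lemma dil_inv_dil {a b : ℝ} (ha : a ≠ 0) (hb : b ≠ 0) (w : KineticSpace d) :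
    dil a⁻¹ b⁻¹ (dil a b w) = w := by
  simpa using dil_dil_inv (inv_ne_zero ha) (inv_ne_zero hb) w

lemma lintegral_kineticSpace {H : KineticSpace d → ℝ≥0∞} (hH : Measurable H) :
    ∫⁻ z, H z = ∫⁻ t : ℝ, ∫⁻ x : Rd d, ∫⁻ v : Rd d, H (t, x, v) := by
  rw [Measure.volume_eq_prod, lintegral_prod _ hH.aemeasurable]
  refine lintegral_congr fun t => ?_
  rw [Measure.volume_eq_prod, lintegral_prod _ (by fun_prop)]

lemma lintegral_kineticSpace' {H : KineticSpace d → ℝ≥0∞} (hH : Measurable H) :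
    ∫⁻ z, H z = ∫⁻ t : ℝ, ∫⁻ v : Rd d, ∫⁻ x : Rd d, H (t, x, v) := by
  rw [lintegral_kineticSpace hH]
  refine lintegral_congr fun t => ?_
  rw [lintegral_lintegral_swap]
  fun_prop

lemma measurePreserving_of_lintegral {α : Type*} [MeasurableSpace α] {μ ν : Measure α} {T : α → α}
    (hT : Measurable T)
    (h : ∀ H : α → ℝ≥0∞, Measurable H → ∫⁻ z, H (T z) ∂μ = ∫⁻ z, H z ∂ν) :
    MeasurePreserving T μ ν := by
  refine ⟨hT, Measure.ext_of_lintegral _ fun H hH => ?_⟩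
  rw [lintegral_map hH hT, h H hH]

lemma measurePreserving_gmul_right (u : KineticSpace d) :
    MeasurePreserving (fun z : KineticSpace d => gmul z u) := by
  have hc : Continuous (fun z : KineticSpace d => gmul z u) := by fun_prop
  refine measurePreserving_of_lintegral hc.measurable fun H hH => ?_
  rw [lintegral_kineticSpace' (H := fun z => H (gmul z u))
    (hH.comp hc.measurable), lintegral_kineticSpace' hH]
  simp only [gmul]
  have h1 : ∀ (t : ℝ) (v : Rd d), ∫⁻ x : Rd d, H (t + u.1, x + u.2.1 + u.1 • v, v + u.2.2) =
      ∫⁻ x : Rd d, H (t + u.1, x, v + u.2.2) := fun t v => by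
    simp only [add_assoc]
    exact lintegral_add_right_eq_self (fun x => H (t + u.1, x, v + u.2.2)) _
  simp only [h1]
  have h2 : ∀ t : ℝ, ∫⁻ v : Rd d, ∫⁻ x : Rd d, H (t + u.1, x, v + u.2.2) =
      ∫⁻ v : Rd d, ∫⁻ x : Rd d, H (t + u.1, x, v) := fun t =>
    lintegral_add_right_eq_self (fun v => ∫⁻ x : Rd d, H (t + u.1, x, v)) _
  simp only [h2]
  exact lintegral_add_right_eq_self (fun t => ∫⁻ v : Rd d, ∫⁻ x : Rd d, H (t, x, v)) _

lemma measurePreserving_gmul_left (z : KineticSpace d) :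
    MeasurePreserving (fun u : KineticSpace d => gmul z u) := by
  have hc : Continuous (fun u : KineticSpace d => gmul z u) := by fun_prop
  refine measurePreserving_of_lintegral hc.measurable fun H hH => ?_
  rw [lintegral_kineticSpace (H := fun u => H (gmul z u))
    (hH.comp hc.measurable), lintegral_kineticSpace hH]
  simp only [gmul]
  have h1 : ∀ (t : ℝ) (x : Rd d), ∫⁻ v : Rd d, H (z.1 + t, z.2.1 + x + t • z.2.2, z.2.2 + v) =
      ∫⁻ v : Rd d, H (z.1 + t, x + (z.2.1 + t • z.2.2), v) := fun t x => by
    rw [show z.2.1 + x + t • z.2.2 = x + (z.2.1 + t • z.2.2) by abel]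
    exact lintegral_add_left_eq_self (fun v => H (z.1 + t, x + (z.2.1 + t • z.2.2), v)) _
  simp only [h1]
  have h2 : ∀ t : ℝ, ∫⁻ x : Rd d, ∫⁻ v : Rd d, H (z.1 + t, x + (z.2.1 + t • z.2.2), v) =
      ∫⁻ x : Rd d, ∫⁻ v : Rd d, H (z.1 + t, x, v) := fun t =>
    lintegral_add_right_eq_self (fun x => ∫⁻ v : Rd d, H (z.1 + t, x, v)) _
  simp only [h2]
  exact lintegral_add_left_eq_self (fun t => ∫⁻ x : Rd d, ∫⁻ v : Rd d, H (t, x, v)) _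

lemma measurePreserving_ginv : MeasurePreserving (ginv (d := d)) := by
  have hc := continuous_ginv (d := d)
  refine measurePreserving_of_lintegral hc.measurable fun H hH => ?_
  rw [lintegral_kineticSpace' (H := fun z => H (ginv z))
    (hH.comp hc.measurable), lintegral_kineticSpace' hH]
  simp only [ginv]
  have h1 : ∀ (t : ℝ) (v : Rd d), ∫⁻ x : Rd d, H (-t, -x + t • v, -v) =
      ∫⁻ x : Rd d, H (-t, x, -v) := fun t v => by
    simp only [neg_add_eq_sub]
    exact lintegral_sub_left_eq_self (fun x => H (-t, x, -v)) _
  simp only [h1]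
  have h2 : ∀ t : ℝ, ∫⁻ v : Rd d, ∫⁻ x : Rd d, H (-t, x, -v) =
      ∫⁻ v : Rd d, ∫⁻ x : Rd d, H (-t, x, v) := fun t =>
    lintegral_neg_eq_self (fun v => ∫⁻ x : Rd d, H (-t, x, v))
  simp only [h2]
  exact lintegral_neg_eq_self (fun t => ∫⁻ v : Rd d, ∫⁻ x : Rd d, H (t, x, v))

lemma lintegral_comp_smul {E : Type*} [NormedAddCommGroup E] [NormedSpace ℝ E] [MeasurableSpace E]
    [BorelSpace E] [FiniteDimensional ℝ E] (μ : Measure E) [μ.IsAddHaarMeasure] {c : ℝ}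
    (hc : 0 < c) {H : E → ℝ≥0∞} (hH : Measurable H) :
    ∫⁻ x, H (c • x) ∂μ = ENNReal.ofReal ((c ^ Module.finrank ℝ E)⁻¹) * ∫⁻ x, H x ∂μ := by
  rw [← lintegral_map hH (measurable_const_smul c), Measure.map_addHaar_smul μ hc.ne',
    lintegral_smul_measure, abs_of_pos (by positivity), smul_eq_mul]

lemma lintegral_comp_dil {a b : ℝ} (ha : 0 < a) (hb : 0 < b) {H : KineticSpace d → ℝ≥0∞}
    (hH : Measurable H) :
    ∫⁻ w, H (dil a b w) = ENNReal.ofReal ((a ^ (d + 1) * b ^ (2 * d))⁻¹) * ∫⁻ w, H w := by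
  have hc : Continuous (dil (d := d) a b) := by unfold dil; fun_prop
  rw [lintegral_kineticSpace (H := fun w => H (dil a b w))
    (hH.comp hc.measurable), lintegral_kineticSpace hH]
  simp only [dil]
  have h1 : ∀ (t : ℝ) (x : Rd d), ∫⁻ v : Rd d, H (a * t, (a * b) • x, b • v) =
      ENNReal.ofReal ((b ^ d)⁻¹) * ∫⁻ v : Rd d, H (a * t, (a * b) • x, v) := fun t x => by
    have := lintegral_comp_smul (volume : Measure (Rd d)) hb
      (H := fun v => H (a * t, (a * b) • x, v)) (by fun_prop)
    simpa using this
  have h2 : ∀ (t : ℝ), ∫⁻ x : Rd d, ∫⁻ v : Rd d, H (a * t, (a * b) • x, v) =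
      ENNReal.ofReal (((a * b) ^ d)⁻¹) * ∫⁻ x : Rd d, ∫⁻ v : Rd d, H (a * t, x, v) := fun t => by
    have := lintegral_comp_smul (volume : Measure (Rd d)) (mul_pos ha hb)
      (H := fun x => ∫⁻ v : Rd d, H (a * t, x, v)) (by fun_prop)
    simpa using this
  have h3 : ∫⁻ t : ℝ, ∫⁻ x : Rd d, ∫⁻ v : Rd d, H (a * t, x, v) =
      ENNReal.ofReal a⁻¹ * ∫⁻ t : ℝ, ∫⁻ x : Rd d, ∫⁻ v : Rd d, H (t, x, v) := by
    have := lintegral_comp_smul (volume : Measure ℝ) ha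
      (H := fun t => ∫⁻ x : Rd d, ∫⁻ v : Rd d, H (t, x, v)) (by fun_prop)
    simpa using this
  simp only [h1, lintegral_const_mul' _ _ ENNReal.ofReal_ne_top, h2, h3]
  rw [← mul_assoc, ← mul_assoc, ← ENNReal.ofReal_mul (by positivity),
    ← ENNReal.ofReal_mul (by positivity)]
  congr 2
  field_simp
  ring

/-! ### The Hardy–Littlewood–Sobolev inequality -/

section HardyLittlewoodSobolev

lemma exists_lintegral_exp_mul_min_le {α β : ℝ} (hα : 0 < α) (hαβ : α < β) :
    ∃ C : ℝ≥0∞, C ≠ ⊤ ∧ ∀ L : ℝ≥0∞, L ≠ ⊤ →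
      ∫⁻ τ : ℝ, ENNReal.ofReal (Real.exp (α * τ)) * min L (ENNReal.ofReal (Real.exp (-(β * τ))))
        ≤ C * L ^ (1 - α / β) := by
  have hβ : 0 < β := hα.trans hαβ
  have hexp : 0 < 1 - α / β := by
    rw [sub_pos, div_lt_one hβ]; exact hαβ
  refine ⟨∫⁻ τ : ℝ, ENNReal.ofReal (Real.exp (α * τ)) *
    min 1 (ENNReal.ofReal (Real.exp (-(β * τ)))), ?_, fun L hL => ?_⟩
  · have h1 : ∫⁻ τ in Set.Iic (0 : ℝ), ENNReal.ofReal (Real.exp (α * τ)) *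
        min 1 (ENNReal.ofReal (Real.exp (-(β * τ)))) < ⊤ := by
      have hi : IntegrableOn (fun τ : ℝ => Real.exp (α * τ)) (Set.Iic 0) :=
        integrableOn_exp_mul_Iic hα 0
      refine lt_of_le_of_lt (lintegral_mono fun τ => ?_) hi.lintegral_lt_top
      exact (mul_le_mul_right (min_le_left _ _) _).trans (mul_one _).le
    have h2 : ∫⁻ τ in Set.Ioi (0 : ℝ), ENNReal.ofReal (Real.exp (α * τ)) *
        min 1 (ENNReal.ofReal (Real.exp (-(β * τ)))) < ⊤ := by
      have hi : IntegrableOn (fun τ : ℝ => Real.exp ((α - β) * τ)) (Set.Ioi 0) :=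
        integrableOn_exp_mul_Ioi (by linarith) 0
      refine lt_of_le_of_lt (lintegral_mono fun τ => ?_) hi.lintegral_lt_top
      refine (mul_le_mul_right (min_le_right _ _) _).trans ?_
      rw [← ENNReal.ofReal_mul (Real.exp_pos _).le, ← Real.exp_add]
      exact le_of_eq (by congr 2; ring)
    rw [← lintegral_add_compl _ (measurableSet_Iic (a := (0 : ℝ))), Set.compl_Iic]
    exact (ENNReal.add_lt_top.2 ⟨h1, h2⟩).ne
  · rcases eq_or_ne L 0 with rfl | hL0
    · simp
    -- the substitution `τ = σ + σ₀` with `exp (-β σ₀) = L`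
    obtain ⟨l, hl, rfl⟩ : ∃ l : ℝ, 0 < l ∧ L = ENNReal.ofReal l :=
      ⟨L.toReal, ENNReal.toReal_pos hL0 hL, (ENNReal.ofReal_toReal hL).symm⟩
    set σ₀ : ℝ := -(Real.log l / β) with hσ
    rw [← lintegral_add_right_eq_self _ σ₀]
    have key : ∀ σ : ℝ, ENNReal.ofReal (Real.exp (α * (σ + σ₀))) *
        min (ENNReal.ofReal l) (ENNReal.ofReal (Real.exp (-(β * (σ + σ₀))))) =
        ENNReal.ofReal l ^ (1 - α / β) * (ENNReal.ofReal (Real.exp (α * σ)) *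
          min 1 (ENNReal.ofReal (Real.exp (-(β * σ))))) := fun σ => by
      have e1 : Real.exp (-(β * (σ + σ₀))) = l * Real.exp (-(β * σ)) := by
        conv_rhs => rw [← Real.exp_log hl]
        rw [← Real.exp_add, hσ]; congr 1; field_simp; ring
      have e2 : Real.exp (α * (σ + σ₀)) * l = l ^ (1 - α / β) * Real.exp (α * σ) := by
        rw [Real.rpow_def_of_pos hl]
        conv_lhs => rhs; rw [← Real.exp_log hl]
        rw [← Real.exp_add, ← Real.exp_add, hσ]; congr 1; field_simp; ring
      rw [e1, ENNReal.ofReal_rpow_of_pos hl, ENNReal.ofReal_mul hl.le]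
      nth_rewrite 1 [← mul_one (ENNReal.ofReal l)]
      rw [← mul_min, ← mul_assoc, ← mul_assoc, ← ENNReal.ofReal_mul (by positivity),
        ← ENNReal.ofReal_mul (by positivity), e2]
    simp only [key]
    rw [lintegral_const_mul _ (by fun_prop), mul_comm]

/-- A form of Hölder's inequality with the unit ball of `L^p` built in: it follows from
`x ≤ m + m ^ (1 - p) * x ^ p` with `m = exp E`. -/
lemma setLIntegral_le_of_lintegral_rpow_le {W : Type*} [MeasurableSpace W] {ν : Measure W}
    {p : ℝ} (hp : 1 ≤ p) {Q : Set W} {H : W → ℝ≥0∞} (hH : Measurable H) {E A : ℝ} (hA : 0 ≤ A)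
    (h : ∫⁻ w, H w ^ p ∂ν ≤ ENNReal.ofReal (A * Real.exp (p * E))) :
    ∫⁻ w in Q, H w ∂ν ≤ (ν Q + ENNReal.ofReal A) * ENNReal.ofReal (Real.exp E) := by
  have hm : ENNReal.ofReal (Real.exp E) ≠ 0 := by
    simpa using Real.exp_pos E
  have hp0 : 0 < p := by linarith
  have key : ∀ x : ℝ≥0∞, x ≤ ENNReal.ofReal (Real.exp E) +
      ENNReal.ofReal (Real.exp ((1 - p) * E)) * x ^ p := by
    intro x
    rcases le_or_gt x (ENNReal.ofReal (Real.exp E)) with hx | hx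
    · exact hx.trans le_self_add
    refine le_trans ?_ le_add_self
    rcases eq_or_ne x ⊤ with rfl | hxt
    · rw [ENNReal.top_rpow_of_pos hp0, ENNReal.mul_top (by simpa using Real.exp_pos _)]
    have hx0 : x ≠ 0 := (lt_of_le_of_lt zero_le hx).ne'
    calc x = x ^ (1 - p) * x ^ p := by
          rw [← ENNReal.rpow_add _ _ hx0 hxt]; simp
      _ ≤ _ := by
          gcongr
          have : ENNReal.ofReal (Real.exp ((1 - p) * E)) =
              ENNReal.ofReal (Real.exp E) ^ (1 - p) := by
            rw [ENNReal.ofReal_rpow_of_pos (Real.exp_pos _), ← Real.exp_mul, mul_comm]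
          rw [this]
          rw [show (1 - p) = -(p - 1) by ring, ENNReal.rpow_neg, ENNReal.rpow_neg]
          exact ENNReal.inv_le_inv.2 (ENNReal.rpow_le_rpow hx.le (by linarith))
  calc ∫⁻ w in Q, H w ∂ν
      ≤ ∫⁻ w in Q, (ENNReal.ofReal (Real.exp E) +
          ENNReal.ofReal (Real.exp ((1 - p) * E)) * H w ^ p) ∂ν := lintegral_mono fun w => key _
    _ = ENNReal.ofReal (Real.exp E) * ν Q +
          ENNReal.ofReal (Real.exp ((1 - p) * E)) * ∫⁻ w in Q, H w ^ p ∂ν := by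
        rw [lintegral_add_left measurable_const, setLIntegral_const,
          lintegral_const_mul _ (by fun_prop)]
    _ ≤ ENNReal.ofReal (Real.exp E) * ν Q + ENNReal.ofReal (Real.exp ((1 - p) * E)) *
          ENNReal.ofReal (A * Real.exp (p * E)) := by
        gcongr
        exact (setLIntegral_le_lintegral _ _).trans h
    _ = _ := by
        rw [← ENNReal.ofReal_mul (Real.exp_pos _).le, mul_comm (ENNReal.ofReal (Real.exp E)),
          add_mul, ← ENNReal.ofReal_mul hA]
        congr 2
        rw [mul_left_comm, ← Real.exp_add]
        congr 2; ring

variable {Z : Type*} [MeasureSpace Z] [SFinite (volume : Measure Z)]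

open Classical in
/-- The part of the trilinear form below on which `h ≤ k ^ (s / p)`. Freezing `z`, the truncated
`h` satisfies both an `L^∞` and an `L^p` bound at every scale, and the integral over the scales
converges. -/
lemma exists_truncated_form_le {N α p s : ℝ} (hN : 0 < N) (hα : 0 < α) (hp : 1 < p) (hs : 1 < s)
    (hps : 1 / p + 1 / s = 1 + α / N) {Q : Set Z} (hQ : volume Q ≠ ⊤) :
    ∃ C : ℝ≥0∞, C ≠ ⊤ ∧ ∀ Φ : ℝ → Z → Z → Z,
      Measurable (fun q : ℝ × Z × Z => Φ q.1 q.2.1 q.2.2) →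
      (∀ τ z, ∀ H : Z → ℝ≥0∞, Measurable H →
        ∫⁻ w, H (Φ τ z w) = ENNReal.ofReal (Real.exp (-(N * τ))) * ∫⁻ y, H y) →
      ∀ h k : Z → ℝ≥0∞, Measurable h → Measurable k → (∀ z, k z ≠ ⊤) →
        ∫⁻ z, h z ^ p ≤ 1 → ∫⁻ z, k z ^ s ≤ 1 →
        ∫⁻ τ : ℝ, ENNReal.ofReal (Real.exp (α * τ)) * ∫⁻ z, k z * ∫⁻ w in Q,
          (if h (Φ τ z w) ≤ k z ^ (s / p) then h (Φ τ z w) else 0) ≤ C := by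
  have hp0 : 0 < p := by linarith
  have hs0 : 0 < s := by linarith
  have hlt : α < N / p := by
    have h1 : 1 / s < 1 := by rw [div_lt_one hs0]; exact hs
    have h2 : α / N < 1 / p := by linarith
    rw [div_lt_div_iff₀ hN hp0] at h2
    rw [lt_div_iff₀ hp0]; linarith
  obtain ⟨C, hC, hCL⟩ := exists_lintegral_exp_mul_min_le hα hlt
  refine ⟨(volume Q + 1) * C, ENNReal.mul_ne_top (by simp [hQ]) hC, ?_⟩
  intro Φ hΦm hΦ h k hh hk hkt hhp hks
  have hhΦ : Measurable (fun q : ℝ × Z × Z => h (Φ q.1 q.2.1 q.2.2)) := hh.comp hΦm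
  have hg : Measurable (fun q : ℝ × Z × Z =>
      if h (Φ q.1 q.2.1 q.2.2) ≤ k q.2.1 ^ (s / p) then h (Φ q.1 q.2.1 q.2.2) else 0) :=
    Measurable.ite (measurableSet_le hhΦ (by fun_prop)) hhΦ measurable_const
  have hgi : Measurable (fun r : ℝ × Z => ∫⁻ w in Q,
      (if h (Φ r.1 r.2 w) ≤ k r.2 ^ (s / p) then h (Φ r.1 r.2 w) else 0)) :=
    Measurable.lintegral_prod_right' (f := fun q : (ℝ × Z) × Z =>
      if h (Φ q.1.1 q.1.2 q.2) ≤ k q.1.2 ^ (s / p) then h (Φ q.1.1 q.1.2 q.2) else 0)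
      (hg.comp (MeasurableEquiv.prodAssoc.measurable))
  calc ∫⁻ τ : ℝ, ENNReal.ofReal (Real.exp (α * τ)) * ∫⁻ z, k z * ∫⁻ w in Q,
          (if h (Φ τ z w) ≤ k z ^ (s / p) then h (Φ τ z w) else 0)
      = ∫⁻ τ : ℝ, ∫⁻ z, ENNReal.ofReal (Real.exp (α * τ)) * (k z * ∫⁻ w in Q,
          (if h (Φ τ z w) ≤ k z ^ (s / p) then h (Φ τ z w) else 0)) := by
        refine lintegral_congr fun τ => ?_
        rw [lintegral_const_mul]
        exact hk.mul (hgi.comp measurable_prodMk_left)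
    _ = ∫⁻ z, ∫⁻ τ : ℝ, ENNReal.ofReal (Real.exp (α * τ)) * (k z * ∫⁻ w in Q,
          (if h (Φ τ z w) ≤ k z ^ (s / p) then h (Φ τ z w) else 0)) := by
        rw [lintegral_lintegral_swap]
        refine Measurable.aemeasurable ?_
        exact Measurable.mul (by fun_prop) ((hk.comp measurable_snd).mul hgi)
    _ ≤ ∫⁻ z, k z * ((volume Q + 1) * (C * (k z ^ (s / p)) ^ (1 - α / (N / p)))) := by
        refine lintegral_mono fun z => ?_
        calc ∫⁻ τ : ℝ, ENNReal.ofReal (Real.exp (α * τ)) * (k z * ∫⁻ w in Q,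
              (if h (Φ τ z w) ≤ k z ^ (s / p) then h (Φ τ z w) else 0))
            ≤ ∫⁻ τ : ℝ, k z * ((volume Q + 1) * (ENNReal.ofReal (Real.exp (α * τ)) *
              min (k z ^ (s / p)) (ENNReal.ofReal (Real.exp (-(N / p * τ)))))) := by
              refine lintegral_mono fun τ => ?_
              have hb : ∫⁻ w in Q,
                  (if h (Φ τ z w) ≤ k z ^ (s / p) then h (Φ τ z w) else 0) ≤
                  (volume Q + 1) *
                    min (k z ^ (s / p)) (ENNReal.ofReal (Real.exp (-(N / p * τ)))) := by
                rw [mul_min]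
                refine le_min ?_ ?_
                · calc _ ≤ ∫⁻ w in Q, k z ^ (s / p) := by
                        refine lintegral_mono fun w => ?_
                        split_ifs with hc
                        · exact hc
                        · exact zero_le
                    _ ≤ _ := by
                        rw [setLIntegral_const, mul_comm]
                        gcongr
                        exact le_self_add
                · have hw : Measurable (fun w => h (Φ τ z w)) :=
                    hhΦ.comp (f := fun w => (τ, z, w)) (by fun_prop)
                  refine (lintegral_mono (g := fun w => h (Φ τ z w)) fun w => ?_).trans ?_
                  · dsimp only
                    split_ifs
                    · exact le_rfl
                    · exact zero_le
                  · have := setLIntegral_le_of_lintegral_rpow_le (ν := (volume : Measure Z))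
                      (Q := Q) hp.le hw (E := -(N / p * τ)) zero_le_one (by
                        rw [hΦ τ z (fun y => h y ^ p) (by fun_prop), one_mul,
                          show p * -(N / p * τ) = -(N * τ) by field_simp]
                        exact (mul_le_mul_right hhp _).trans (mul_one _).le)
                    simpa using this
              calc _ = k z * (ENNReal.ofReal (Real.exp (α * τ)) * ∫⁻ w in Q,
                    (if h (Φ τ z w) ≤ k z ^ (s / p) then h (Φ τ z w) else 0)) := by ring
                _ ≤ k z * (ENNReal.ofReal (Real.exp (α * τ)) * ((volume Q + 1) *
                    min (k z ^ (s / p)) (ENNReal.ofReal (Real.exp (-(N / p * τ)))))) := by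
                    gcongr
                _ = _ := by ring
          _ ≤ _ := by
              rw [lintegral_const_mul' _ _ (hkt z), lintegral_const_mul' _ _ (by simp [hQ])]
              gcongr
              exact hCL _ (ENNReal.rpow_ne_top_of_nonneg (by positivity) (hkt z))
    _ = (volume Q + 1) * C * ∫⁻ z, k z ^ s := by
        rw [← lintegral_const_mul _ (by fun_prop)]
        refine lintegral_congr fun z => ?_
        have e : k z ^ s = k z * (k z ^ (s / p)) ^ (1 - α / (N / p)) := by
          rcases eq_or_ne (k z) 0 with h0 | h0
          · rw [h0, ENNReal.zero_rpow_of_pos hs0, zero_mul]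
          rw [← ENNReal.rpow_mul]
          nth_rewrite 2 [← ENNReal.rpow_one (k z)]
          rw [← ENNReal.rpow_add _ _ h0 (hkt z)]
          congr 1
          have h3 : α / N = 1 / p + 1 / s - 1 := by linarith
          have h4 : α / (N / p) = p * (α / N) := by field_simp
          rw [h4, h3]
          field_simp
          ring
        rw [e]; ring
    _ ≤ (volume Q + 1) * C := (mul_le_mul_right hks _).trans (mul_one _).le

open Classical in
/-- **Hardy–Littlewood–Sobolev inequality** in trilinear form, for averages over the sets
`Φ τ z '' Q`, whose measure is proportional to `exp (N * τ)`. The two truncated forms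
`h ≤ k ^ (s / p)` and `k ≤ h ^ (p / s)` exhaust the whole form; the second is turned into the first
by exchanging the base point `z` with the point `Φ τ z w`. -/
theorem exists_hardyLittlewoodSobolev {N α p s : ℝ} (hN : 0 < N) (hα : 0 < α) (hp : 1 < p)
    (hs : 1 < s) (hps : 1 / p + 1 / s = 1 + α / N) {Q : Set Z}
    (hQ : volume Q ≠ ⊤) :
    ∃ C : ℝ≥0∞, C ≠ ⊤ ∧ ∀ Φ Ψ : ℝ → Z → Z → Z,
      Measurable (fun q : ℝ × Z × Z => Φ q.1 q.2.1 q.2.2) →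
      Measurable (fun q : ℝ × Z × Z => Ψ q.1 q.2.1 q.2.2) →
      (∀ τ z, ∀ H : Z → ℝ≥0∞, Measurable H →
        ∫⁻ w, H (Φ τ z w) = ENNReal.ofReal (Real.exp (-(N * τ))) * ∫⁻ y, H y) →
      (∀ τ z, ∀ H : Z → ℝ≥0∞, Measurable H →
        ∫⁻ w, H (Ψ τ z w) = ENNReal.ofReal (Real.exp (-(N * τ))) * ∫⁻ y, H y) →
      (∀ τ w, MeasurePreserving (fun z => Φ τ z w)) →
      (∀ τ w z, Ψ τ (Φ τ z w) w = z) →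
      ∀ h k : Z → ℝ≥0∞, Measurable h → Measurable k → (∀ z, h z ≠ ⊤) → (∀ z, k z ≠ ⊤) →
        ∫⁻ z, h z ^ p ≤ 1 → ∫⁻ z, k z ^ s ≤ 1 →
        ∫⁻ τ : ℝ, ENNReal.ofReal (Real.exp (α * τ)) * ∫⁻ z, k z * ∫⁻ w in Q, h (Φ τ z w) ≤ C := by
  have hp0 : 0 < p := by linarith
  have hs0 : 0 < s := by linarith
  obtain ⟨C₁, hC₁, H₁⟩ := exists_truncated_form_le hN hα hp hs hps hQ
  obtain ⟨C₂, hC₂, H₂⟩ := exists_truncated_form_le hN hα hs hp (by linarith) hQ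
  refine ⟨C₁ + C₂, ENNReal.add_ne_top.2 ⟨hC₁, hC₂⟩, ?_⟩
  intro Φ Ψ hΦm hΨm hΦ hΨ hΦp hΨΦ h k hh hk hht hkt hhp hks
  have B₁ := H₁ Φ hΦm hΦ h k hh hk hkt hhp hks
  have B₂ := H₂ Ψ hΨm hΨ k h hk hh hht hks hhp
  have mΦ : ∀ τ, Measurable (fun q : Z × Z => Φ τ q.1 q.2) := fun τ =>
    hΦm.comp (f := fun q : Z × Z => (τ, q.1, q.2)) (by fun_prop)
  have mΨ : ∀ τ, Measurable (fun q : Z × Z => Ψ τ q.1 q.2) := fun τ =>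
    hΨm.comp (f := fun q : Z × Z => (τ, q.1, q.2)) (by fun_prop)
  have hG : ∀ τ, Measurable (fun q : Z × Z =>
      if h (Φ τ q.1 q.2) ≤ k q.1 ^ (s / p) then h (Φ τ q.1 q.2) else 0) := fun τ =>
    Measurable.ite (measurableSet_le (hh.comp (mΦ τ)) (by fun_prop)) (hh.comp (mΦ τ))
      measurable_const
  have hG' : ∀ τ, Measurable (fun q : Z × Z =>
      if k q.1 ≤ h (Φ τ q.1 q.2) ^ (p / s) then h (Φ τ q.1 q.2) else 0) := fun τ =>
    Measurable.ite (measurableSet_le (by fun_prop) ((hh.comp (mΦ τ)).pow_const _))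
      (hh.comp (mΦ τ)) measurable_const
  have hswap : ∀ τ, ∫⁻ z, k z * ∫⁻ w in Q,
        (if k z ≤ h (Φ τ z w) ^ (p / s) then h (Φ τ z w) else 0) =
      ∫⁻ y, h y * ∫⁻ w in Q, (if k (Ψ τ y w) ≤ h y ^ (p / s) then k (Ψ τ y w) else 0) := by
    intro τ
    have hR : Measurable (fun q : Z × Z =>
        if k (Ψ τ q.1 q.2) ≤ h q.1 ^ (p / s) then k (Ψ τ q.1 q.2) else 0) :=
      Measurable.ite (measurableSet_le (hk.comp (mΨ τ)) (by fun_prop)) (hk.comp (mΨ τ))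
        measurable_const
    calc _ = ∫⁻ z, ∫⁻ w in Q, k z *
            (if k z ≤ h (Φ τ z w) ^ (p / s) then h (Φ τ z w) else 0) := by
          refine lintegral_congr fun z => ?_
          rw [lintegral_const_mul' _ _ (hkt z)]
      _ = ∫⁻ w in Q, ∫⁻ z, k z *
            (if k z ≤ h (Φ τ z w) ^ (p / s) then h (Φ τ z w) else 0) := by
          rw [lintegral_lintegral_swap]
          exact ((hk.comp measurable_fst).mul (hG' τ)).aemeasurable
      _ = ∫⁻ w in Q, ∫⁻ y, h y *
            (if k (Ψ τ y w) ≤ h y ^ (p / s) then k (Ψ τ y w) else 0) := by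
          refine lintegral_congr fun w => ?_
          have hRw : Measurable (fun y => h y *
              (if k (Ψ τ y w) ≤ h y ^ (p / s) then k (Ψ τ y w) else 0)) :=
            hh.mul (hR.comp (measurable_prodMk_right (y := w)))
          rw [← (hΦp τ w).lintegral_comp hRw]
          refine lintegral_congr fun z => ?_
          rw [hΨΦ]
          split_ifs <;> ring
      _ = ∫⁻ y, ∫⁻ w in Q, h y *
            (if k (Ψ τ y w) ≤ h y ^ (p / s) then k (Ψ τ y w) else 0) := by
          rw [lintegral_lintegral_swap]
          exact (((hh.comp measurable_fst).mul hR).comp measurable_swap).aemeasurable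
      _ = _ := by
          refine lintegral_congr fun y => ?_
          rw [lintegral_const_mul' _ _ (hht y)]
  have hGm : Measurable (fun r : ℝ × Z => ∫⁻ w in Q,
      (if h (Φ r.1 r.2 w) ≤ k r.2 ^ (s / p) then h (Φ r.1 r.2 w) else 0)) := by
    have hhΦ : Measurable (fun q : ℝ × Z × Z => h (Φ q.1 q.2.1 q.2.2)) := hh.comp hΦm
    have hg : Measurable (fun q : ℝ × Z × Z =>
        if h (Φ q.1 q.2.1 q.2.2) ≤ k q.2.1 ^ (s / p) then h (Φ q.1 q.2.1 q.2.2) else 0) :=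
      Measurable.ite (measurableSet_le hhΦ (by fun_prop)) hhΦ measurable_const
    exact Measurable.lintegral_prod_right' (f := fun q : (ℝ × Z) × Z =>
      if h (Φ q.1.1 q.1.2 q.2) ≤ k q.1.2 ^ (s / p) then h (Φ q.1.1 q.1.2 q.2) else 0)
      (hg.comp (MeasurableEquiv.prodAssoc.measurable))
  have hGm2 : Measurable (fun τ : ℝ => ENNReal.ofReal (Real.exp (α * τ)) *
      ∫⁻ z, k z * ∫⁻ w in Q,
        (if h (Φ τ z w) ≤ k z ^ (s / p) then h (Φ τ z w) else 0)) :=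
    Measurable.mul (by fun_prop) (Measurable.lintegral_prod_right'
      (f := fun r : ℝ × Z => k r.2 * ∫⁻ w in Q,
        (if h (Φ r.1 r.2 w) ≤ k r.2 ^ (s / p) then h (Φ r.1 r.2 w) else 0))
      ((hk.comp measurable_snd).mul hGm))
  refine le_trans ?_ (add_le_add B₁ B₂)
  rw [← lintegral_add_left hGm2]
  refine lintegral_mono fun τ => ?_
  dsimp only
  rw [← hswap τ, ← mul_add, ← lintegral_add_left]
  · gcongr with z
    rw [← mul_add, ← lintegral_add_left]
    · gcongr with w
      by_cases hc : h (Φ τ z w) ≤ k z ^ (s / p)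
      · rw [if_pos hc]; exact le_self_add
      · have : k z ≤ h (Φ τ z w) ^ (p / s) := by
          have h1 := ENNReal.rpow_le_rpow (not_le.1 hc).le (show 0 ≤ p / s by positivity)
          rwa [← ENNReal.rpow_mul, show s / p * (p / s) = 1 by field_simp, ENNReal.rpow_one] at h1
        rw [if_pos this]; exact le_add_self
    · exact (hG τ).comp measurable_prodMk_left
  · exact hk.mul (hGm.comp measurable_prodMk_left)

end HardyLittlewoodSobolev

/-! ### The generator of the dilations as a kinetic divergence -/

/-- The partial derivative `∂_{x_i} φ`. -/
noncomputable def partialX (i : Fin d) (φ : KineticSpace d → ℝ) (z : KineticSpace d) : ℝ :=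
  fderiv ℝ φ z (0, EuclideanSpace.single i 1, 0)

/-- The coordinate function `t` as a continuous linear map. -/
noncomputable def coordT : KineticSpace d →L[ℝ] ℝ := ContinuousLinearMap.fst ℝ _ _

/-- The coordinate function `x_i` as a continuous linear map. -/
noncomputable def coordX (i : Fin d) : KineticSpace d →L[ℝ] ℝ :=
  (EuclideanSpace.proj i).comp ((ContinuousLinearMap.fst ℝ _ _).comp
    (ContinuousLinearMap.snd ℝ _ _))

/-- The coordinate function `v_i` as a continuous linear map. -/
noncomputable def coordV (i : Fin d) : KineticSpace d →L[ℝ] ℝ :=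
  (EuclideanSpace.proj i).comp ((ContinuousLinearMap.snd ℝ _ _).comp
    (ContinuousLinearMap.snd ℝ _ _))

@[simp] lemma coordT_apply (z : KineticSpace d) : coordT z = z.1 := rfl
@[simp] lemma coordX_apply (i : Fin d) (z : KineticSpace d) : coordX i z = z.2.1 i := rfl
@[simp] lemma coordV_apply (i : Fin d) (z : KineticSpace d) : coordV i z = z.2.2 i := rfl

lemma isTestFunction_fderiv_apply {φ : KineticSpace d → ℝ} (hφ : IsTestFunction φ)
    {u : KineticSpace d → KineticSpace d} (hu : ContDiff ℝ ∞ u) :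
    IsTestFunction (fun z => fderiv ℝ φ z (u z)) := by
  refine ⟨(hφ.1.fderiv_right (m := ∞) le_rfl).clm_apply hu, ?_⟩
  refine (hφ.2.fderiv (𝕜 := ℝ)).mono ?_
  intro z hz
  simp only [Function.mem_support] at hz ⊢
  intro h; exact hz (by rw [h]; rfl)

lemma isTestFunction_partialV {φ : KineticSpace d → ℝ} (hφ : IsTestFunction φ) (i : Fin d) :
    IsTestFunction (partialV i φ) :=
  isTestFunction_fderiv_apply hφ contDiff_const

lemma isTestFunction_transport {φ : KineticSpace d → ℝ} (hφ : IsTestFunction φ) :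
    IsTestFunction (transport φ) :=
  isTestFunction_fderiv_apply hφ (u := fun z => (1, z.2.2, 0)) (by fun_prop)

lemma isTestFunction_mul {φ : KineticSpace d → ℝ} (hφ : IsTestFunction φ)
    {g : KineticSpace d → ℝ} (hg : ContDiff ℝ ∞ g) : IsTestFunction (fun z => g z * φ z) :=
  ⟨hg.mul hφ.1, hφ.2.mul_left⟩

lemma isTestFunction_add {φ ψ : KineticSpace d → ℝ} (hφ : IsTestFunction φ)
    (hψ : IsTestFunction ψ) : IsTestFunction (fun z => φ z + ψ z) :=
  ⟨hφ.1.add hψ.1, hφ.2.add hψ.2⟩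

lemma isTestFunction_neg {φ : KineticSpace d → ℝ} (hφ : IsTestFunction φ) :
    IsTestFunction (fun z => - φ z) :=
  ⟨hφ.1.neg, by simpa [Function.comp_def] using hφ.2.comp_left (g := fun x : ℝ => -x) (by simp)⟩

lemma isTestFunction_sum {φ : Fin d → KineticSpace d → ℝ} (hφ : ∀ i, IsTestFunction (φ i)) :
    IsTestFunction (fun z => ∑ i, φ i z) := by
  have : ∀ s : Finset (Fin d), IsTestFunction (fun z => ∑ i ∈ s, φ i z) := by
    intro s
    induction s using Finset.induction_on with
    | empty => exact ⟨by simpa using contDiff_const, by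
        simp only [Finset.sum_empty]; exact HasCompactSupport.zero⟩
    | insert i s hi ih =>
      simp only [Finset.sum_insert hi]
      exact isTestFunction_add (hφ i) ih
  exact this _

lemma differentiable_of_isTestFunction {φ : KineticSpace d → ℝ} (hφ : IsTestFunction φ) :
    Differentiable ℝ φ := hφ.1.differentiable (by simp)

lemma fderiv_coord_mul (L : KineticSpace d →L[ℝ] ℝ) {φ : KineticSpace d → ℝ}
    (hφ : IsTestFunction φ) (z u : KineticSpace d) :
    fderiv ℝ (fun z => L z * φ z) z u = L z * fderiv ℝ φ z u + L u * φ z := by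
  rw [fderiv_fun_mul (by fun_prop) (differentiable_of_isTestFunction hφ z)]
  simp [mul_comm]

lemma fderiv_expand (φ : KineticSpace d → ℝ) (z u : KineticSpace d) :
    fderiv ℝ φ z u = u.1 * fderiv ℝ φ z (1, 0, 0) + ∑ i, u.2.1 i * partialX i φ z +
      ∑ i, u.2.2 i * partialV i φ z := by
  have hb : ∀ x : Rd d, x = ∑ i, x i • EuclideanSpace.single i (1 : ℝ) := fun x => by
    have := (EuclideanSpace.basisFun (Fin d) ℝ).sum_repr x
    simpa using this.symm
  have hx : ∀ x : Rd d, fderiv ℝ φ z (0, x, 0) = ∑ i, x i * partialX i φ z := fun x => by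
    have : ((0, x, 0) : KineticSpace d) =
        ∑ i, x i • ((0, EuclideanSpace.single i (1 : ℝ), 0) : KineticSpace d) := by
      refine Prod.ext (by simp [Prod.fst_sum]) (Prod.ext ?_ (by simp [Prod.snd_sum]))
      simpa [Prod.fst_sum, Prod.snd_sum] using hb x
    rw [this, map_sum]
    simp only [map_smul, smul_eq_mul, partialX]
  have hv : ∀ x : Rd d, fderiv ℝ φ z (0, 0, x) = ∑ i, x i * partialV i φ z := fun x => by
    have : ((0, 0, x) : KineticSpace d) =
        ∑ i, x i • ((0, 0, EuclideanSpace.single i (1 : ℝ)) : KineticSpace d) := by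
      refine Prod.ext (by simp [Prod.fst_sum]) (Prod.ext (by simp [Prod.snd_sum, Prod.fst_sum]) ?_)
      simpa [Prod.snd_sum] using hb x
    rw [this, map_sum]
    simp only [map_smul, smul_eq_mul, partialV]
  have hu : u = u.1 • ((1, 0, 0) : KineticSpace d) + (0, u.2.1, 0) + (0, 0, u.2.2) := by
    refine Prod.ext (by simp) (Prod.ext (by simp) (by simp))
  conv_lhs => rw [hu]
  rw [map_add, map_add, map_smul, hx, hv, smul_eq_mul]

/-- The commutator identity `∂_{x_i} = [∂_{v_i}, ∂_t + v · ∇_x]`. -/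
lemma partialX_eq_commutator {φ : KineticSpace d → ℝ} (hφ : IsTestFunction φ) (i : Fin d)
    (z : KineticSpace d) :
    partialX i φ z = partialV i (transport φ) z - transport (partialV i φ) z := by
  have hd : Differentiable ℝ (fderiv ℝ φ) :=
    (hφ.1.fderiv_right (m := ∞) le_rfl).differentiable (by simp)
  have hs : IsSymmSndFDerivAt ℝ φ z :=
    hφ.1.contDiffAt.isSymmSndFDerivAt (by
      rw [minSmoothness_of_isRCLikeNormedField]
      exact WithTop.coe_le_coe.2 (le_top (a := (2 : ℕ∞))))
  let A : KineticSpace d →L[ℝ] KineticSpace d :=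
    (0 : KineticSpace d →L[ℝ] ℝ).prod
      (((ContinuousLinearMap.snd ℝ _ _).comp (ContinuousLinearMap.snd ℝ _ _)).prod 0)
  have h1 : HasFDerivAt (fun z : KineticSpace d => ((1, z.2.2, 0) : KineticSpace d)) A z := by
    have : (fun z : KineticSpace d => ((1, z.2.2, 0) : KineticSpace d)) =
        fun z => (1, 0, 0) + A z := by
      funext z; simp [A]
    rw [this]
    exact A.hasFDerivAt.const_add _
  have h2 := (hd z).hasFDerivAt.clm_apply h1
  have h3 : partialV i (transport φ) z = fderiv ℝ φ z (0, EuclideanSpace.single i 1, 0) +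
      fderiv ℝ (fderiv ℝ φ) z (0, 0, EuclideanSpace.single i 1) (1, z.2.2, 0) := by
    unfold partialV
    rw [show transport φ = fun z => fderiv ℝ φ z (1, z.2.2, 0) from rfl, h2.fderiv]
    simp [A]
  have h4 : transport (partialV i φ) z =
      fderiv ℝ (fderiv ℝ φ) z (1, z.2.2, 0) (0, 0, EuclideanSpace.single i 1) := by
    have h5 := (hd z).hasFDerivAt.clm_apply
      (hasFDerivAt_const ((0, 0, EuclideanSpace.single i 1) : KineticSpace d) z)
    unfold transport
    rw [show partialV i φ = fun z => fderiv ℝ φ z (0, 0, EuclideanSpace.single i 1) from rfl,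
      h5.fderiv]
    simp
  rw [h3, h4, hs.eq]
  simp [partialX]

/-- The function `((1 + κ) x_i - t v_i) φ`. -/
noncomputable def moment (κ : ℝ) (φ : KineticSpace d → ℝ) (i : Fin d) (z : KineticSpace d) : ℝ :=
  ((1 + κ) * z.2.1 i - z.1 * z.2.2 i) * φ z

/-- The generator `-(N + E) φ` of `τ ↦ exp (-N τ) φ ∘ δ_{-τ}`, where `δ_τ` is the dilation
`(exp τ t, exp ((1 + κ) τ) x, exp (κ τ) v)`, `N` is its homogeneous dimension and `E` its Euler
field. -/
noncomputable def dilGen (κ : ℝ) (φ : KineticSpace d → ℝ) (z : KineticSpace d) : ℝ :=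
  -((1 + d + 2 * d * κ) * φ z + fderiv ℝ φ z (z.1, (1 + κ) • z.2.1, κ • z.2.2))

/-- The part of `dilGen κ φ` on which a velocity derivative falls. -/
noncomputable def velField (κ : ℝ) (φ : KineticSpace d → ℝ) (i : Fin d) (z : KineticSpace d) : ℝ :=
  -(κ * (z.2.2 i * φ z) + transport (moment κ φ i) z)

/-- The part of `dilGen κ φ` on which the transport derivative falls. -/
noncomputable def transField (κ : ℝ) (φ : KineticSpace d → ℝ) (z : KineticSpace d) : ℝ :=
  -(z.1 * φ z + -∑ i, partialV i (moment κ φ i) z)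

lemma isTestFunction_moment (κ : ℝ) {φ : KineticSpace d → ℝ} (hφ : IsTestFunction φ) (i : Fin d) :
    IsTestFunction (moment κ φ i) :=
  isTestFunction_mul hφ (g := fun z => (1 + κ) * coordX i z - coordT z * coordV i z) (by fun_prop)

lemma isTestFunction_velField (κ : ℝ) {φ : KineticSpace d → ℝ} (hφ : IsTestFunction φ)
    (i : Fin d) : IsTestFunction (velField κ φ i) :=
  isTestFunction_neg (isTestFunction_add
    (isTestFunction_mul (isTestFunction_mul hφ (coordV i).contDiff) contDiff_const)
    (isTestFunction_transport (isTestFunction_moment κ hφ i)))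

lemma isTestFunction_transField (κ : ℝ) {φ : KineticSpace d → ℝ} (hφ : IsTestFunction φ) :
    IsTestFunction (transField κ φ) :=
  isTestFunction_neg (isTestFunction_add (isTestFunction_mul hφ coordT.contDiff)
    (isTestFunction_neg (isTestFunction_sum fun i =>
      isTestFunction_partialV (isTestFunction_moment κ hφ i) i)))

lemma isTestFunction_dilGen (κ : ℝ) {φ : KineticSpace d → ℝ} (hφ : IsTestFunction φ) :
    IsTestFunction (dilGen κ φ) :=
  isTestFunction_neg (isTestFunction_add (isTestFunction_mul hφ contDiff_const)
    (isTestFunction_fderiv_apply hφ (u := fun z => (z.1, (1 + κ) • z.2.1, κ • z.2.2))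
      (by fun_prop)))

/-- The generator of the dilations is a sum of derivatives that can be moved onto a solution of the
kinetic equation: its `x`-derivatives are commutators of `∂_{v_i}` and `∂_t + v · ∇_x`. -/
theorem dilGen_eq (κ : ℝ) {φ : KineticSpace d → ℝ} (hφ : IsTestFunction φ) (z : KineticSpace d) :
    dilGen κ φ z = ∑ i, partialV i (velField κ φ i) z + transport (transField κ φ) z := by
  have hm := isTestFunction_moment κ hφ
  have hdφ := differentiable_of_isTestFunction hφ
  have hV : ∀ i, partialV i (velField κ φ i) z =
      -(κ * (φ z + z.2.2 i * partialV i φ z)) - partialV i (transport (moment κ φ i)) z := by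
    intro i
    have hvφ : IsTestFunction (fun z : KineticSpace d => z.2.2 i * φ z) :=
      isTestFunction_mul hφ (coordV i).contDiff
    have h1 : DifferentiableAt ℝ (fun z : KineticSpace d => z.2.2 i * φ z) z :=
      differentiable_of_isTestFunction hvφ z
    have h2 : DifferentiableAt ℝ (transport (moment κ φ i)) z :=
      differentiable_of_isTestFunction (isTestFunction_transport (hm i)) z
    have h3 := fderiv_coord_mul (coordV i) hφ z (0, 0, EuclideanSpace.single i 1)
    simp only [coordV_apply] at h3
    unfold partialV
    rw [show velField κ φ i = fun z => -(κ * (z.2.2 i * φ z) + transport (moment κ φ i) z)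
      from rfl, fderiv_fun_neg, fderiv_fun_add (h1.const_mul κ) h2, fderiv_const_mul h1]
    simp only [neg_apply, add_apply,
      smul_apply, h3, smul_eq_mul]
    simp
    ring
  have hT : transport (transField κ φ) z = -(φ z + z.1 * transport φ z) +
      ∑ i, transport (partialV i (moment κ φ i)) z := by
    have htφ : IsTestFunction (fun z : KineticSpace d => z.1 * φ z) :=
      isTestFunction_mul hφ coordT.contDiff
    have h1 : DifferentiableAt ℝ (fun z : KineticSpace d => z.1 * φ z) z :=
      differentiable_of_isTestFunction htφ z
    have h2 : ∀ i, DifferentiableAt ℝ (partialV i (moment κ φ i)) z := fun i =>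
      differentiable_of_isTestFunction (isTestFunction_partialV (hm i) i) z
    have h3 := fderiv_coord_mul coordT hφ z (1, z.2.2, 0)
    simp only [coordT_apply] at h3
    have h4 : DifferentiableAt ℝ (fun z => ∑ i, partialV i (moment κ φ i) z) z :=
      DifferentiableAt.fun_sum fun i _ => h2 i
    unfold transport
    rw [show transField κ φ = fun z => -(z.1 * φ z + -∑ i, partialV i (moment κ φ i) z) from rfl,
      fderiv_fun_neg, fderiv_fun_add h1 h4.fun_neg, fderiv_fun_neg, fderiv_fun_sum fun i _ => h2 i]
    simp only [neg_apply, add_apply,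
      sum_apply, h3]
    ring
  have hX : ∀ i, partialX i (moment κ φ i) z =
      (1 + κ) * φ z + ((1 + κ) * z.2.1 i - z.1 * z.2.2 i) * partialX i φ z := by
    intro i
    have h1 : HasFDerivAt (fun z : KineticSpace d => (1 + κ) * coordX i z - coordT z * coordV i z)
        ((1 + κ) • coordX i - (coordT z • coordV i + coordV i z • coordT)) z :=
      ((coordX i).hasFDerivAt.const_mul _).sub
        (coordT.hasFDerivAt.mul (coordV i).hasFDerivAt)
    have h2 := h1.fun_mul (hdφ z).hasFDerivAt
    unfold partialX
    rw [show moment κ φ i = fun z => ((1 + κ) * coordX i z - coordT z * coordV i z) * φ z from rfl]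
    rw [h2.fderiv]
    simp
    ring
  have hsum : ∀ i, partialV i (velField κ φ i) z + transport (partialV i (moment κ φ i)) z =
      -(κ * (φ z + z.2.2 i * partialV i φ z)) -
      ((1 + κ) * φ z + ((1 + κ) * z.2.1 i - z.1 * z.2.2 i) * partialX i φ z) := by
    intro i
    rw [hV, ← hX, partialX_eq_commutator (hm i)]; ring
  have hT' : transport φ z = fderiv ℝ φ z (1, 0, 0) + ∑ i, z.2.2 i * partialX i φ z := by
    unfold transport; rw [fderiv_expand]; simp
  have hE := fderiv_expand φ z (z.1, (1 + κ) • z.2.1, κ • z.2.2)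
  rw [hT, add_left_comm, ← Finset.sum_add_distrib, Finset.sum_congr rfl fun i _ => hsum i, hT',
    dilGen, hE]
  simp only [PiLp.smul_apply, smul_eq_mul, Finset.sum_sub_distrib, Finset.sum_neg_distrib,
    Finset.sum_add_distrib, mul_add, sub_mul, Finset.sum_const, Finset.card_univ, Fintype.card_fin,
    nsmul_eq_mul, Finset.mul_sum, mul_assoc, neg_add_rev]
  ring

/-! ### Averages over dilated Galilean translates -/

/-- The affine chart `w ↦ z ∘ δ_{a,b} w` of `ℝ^{1+2d}` centred at `z`. -/
def chart (z : KineticSpace d) (a b : ℝ) (w : KineticSpace d) : KineticSpace d :=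
  gmul z (dil a b w)

/-- The inverse of `chart z a b`. -/
noncomputable def chartInv (z : KineticSpace d) (a b : ℝ) (y : KineticSpace d) : KineticSpace d :=
  dil a⁻¹ b⁻¹ (gmul (ginv z) y)

lemma chart_chartInv (z : KineticSpace d) {a b : ℝ} (ha : 0 < a) (hb : 0 < b)
    (y : KineticSpace d) : chart z a b (chartInv z a b y) = y := by
  rw [chart, chartInv, dil_dil_inv ha.ne' hb.ne', gmul_left_cancel']

lemma chartInv_chart (z : KineticSpace d) {a b : ℝ} (ha : 0 < a) (hb : 0 < b)
    (w : KineticSpace d) : chartInv z a b (chart z a b w) = w := by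
  rw [chart, chartInv, gmul_left_cancel, dil_inv_dil ha.ne' hb.ne']

@[fun_prop]
lemma contDiff_chart (z : KineticSpace d) (a b : ℝ) : ContDiff ℝ ∞ (chart z a b) := by
  unfold chart gmul dil; fun_prop

@[fun_prop]
lemma contDiff_chartInv (z : KineticSpace d) (a b : ℝ) : ContDiff ℝ ∞ (chartInv z a b) := by
  unfold chartInv gmul dil ginv; fun_prop

/-- `chart` as a homeomorphism. -/
noncomputable def chartHomeomorph (z : KineticSpace d) {a b : ℝ} (ha : 0 < a) (hb : 0 < b) :
    KineticSpace d ≃ₜ KineticSpace d where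
  toFun := chart z a b
  invFun := chartInv z a b
  left_inv := chartInv_chart z ha hb
  right_inv := chart_chartInv z ha hb
  continuous_toFun := (contDiff_chart z a b).continuous
  continuous_invFun := (contDiff_chartInv z a b).continuous

lemma measurableEmbedding_chart (z : KineticSpace d) {a b : ℝ} (ha : 0 < a) (hb : 0 < b) :
    MeasurableEmbedding (chart z a b) :=
  (chartHomeomorph z ha hb).measurableEmbedding

lemma lintegral_comp_chart (z : KineticSpace d) {a b : ℝ} (ha : 0 < a) (hb : 0 < b)
    {H : KineticSpace d → ℝ≥0∞} (hH : Measurable H) :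
    ∫⁻ w, H (chart z a b w) = ENNReal.ofReal ((a ^ (d + 1) * b ^ (2 * d))⁻¹) * ∫⁻ y, H y := by
  have hm := (measurePreserving_gmul_left z)
  rw [← hm.lintegral_comp hH]
  exact lintegral_comp_dil ha hb (H := fun u => H (gmul z u)) (hH.comp hm.measurable)

lemma map_chart (z : KineticSpace d) {a b : ℝ} (ha : 0 < a) (hb : 0 < b) :
    Measure.map (chart z a b) volume =
      ENNReal.ofReal ((a ^ (d + 1) * b ^ (2 * d))⁻¹) • (volume : Measure (KineticSpace d)) := by
  refine Measure.ext_of_lintegral _ fun H hH => ?_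
  rw [lintegral_map hH (measurableEmbedding_chart z ha hb).measurable,
    lintegral_comp_chart z ha hb hH, lintegral_smul_measure, smul_eq_mul]

lemma integral_comp_chart (z : KineticSpace d) {a b : ℝ} (ha : 0 < a) (hb : 0 < b)
    (g : KineticSpace d → ℝ) :
    ∫ w, g (chart z a b w) = (a ^ (d + 1) * b ^ (2 * d))⁻¹ * ∫ y, g y := by
  rw [← (measurableEmbedding_chart z ha hb).integral_map, map_chart z ha hb,
    integral_smul_measure, ENNReal.toReal_ofReal (by positivity), smul_eq_mul]

lemma integrable_comp_chart (z : KineticSpace d) {a b : ℝ} (ha : 0 < a) (hb : 0 < b)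
    {g : KineticSpace d → ℝ} (hg : Integrable g) : Integrable (fun w => g (chart z a b w)) := by
  refine ((measurableEmbedding_chart z ha hb).integrable_map_iff (g := g)).1 ?_
  rw [map_chart z ha hb]
  exact hg.smul_measure ENNReal.ofReal_ne_top

lemma integrable_mul_of_locallyIntegrable {f φ : KineticSpace d → ℝ} (hf : LocallyIntegrable f)
    (hφ : Continuous φ) (hc : HasCompactSupport φ) : Integrable (fun y => f y * φ y) := by
  simpa using hf.integrable_smul_right_of_hasCompactSupport hφ hc

lemma isTestFunction_comp_chartInv {φ : KineticSpace d → ℝ} (hφ : IsTestFunction φ)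
    (z : KineticSpace d) {a b : ℝ} (ha : 0 < a) (hb : 0 < b) :
    IsTestFunction (fun y => φ (chartInv z a b y)) :=
  ⟨hφ.1.comp (contDiff_chartInv z a b),
    hφ.2.comp_homeomorph (chartHomeomorph z ha hb).symm⟩

lemma integrable_comp_chart_mul {f φ : KineticSpace d → ℝ} (hf : LocallyIntegrable f)
    (hφ : IsTestFunction φ) (z : KineticSpace d) {a b : ℝ} (ha : 0 < a) (hb : 0 < b) :
    Integrable (fun w => f (chart z a b w) * φ w) := by
  have hψ := isTestFunction_comp_chartInv hφ z ha hb
  have := integrable_comp_chart z ha hb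
    (integrable_mul_of_locallyIntegrable hf hψ.1.continuous hψ.2)
  simpa only [chartInv_chart z ha hb] using this

lemma fderiv_comp_chart {ψ : KineticSpace d → ℝ} (hψ : Differentiable ℝ ψ) (z : KineticSpace d)
    (a b : ℝ) (w u : KineticSpace d) :
    fderiv ℝ (fun w => ψ (chart z a b w)) w u =
      fderiv ℝ ψ (chart z a b w) (a * u.1, (a * b) • u.2.1 + (a * u.1) • z.2.2, b • u.2.2) := by
  have e1 : HasFDerivAt (fun w : KineticSpace d => w.1) (ContinuousLinearMap.fst ℝ _ _) w :=
    hasFDerivAt_fst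
  have e2 : HasFDerivAt (fun w : KineticSpace d => w.2.1)
      ((ContinuousLinearMap.fst ℝ _ _).comp (ContinuousLinearMap.snd ℝ _ _)) w :=
    hasFDerivAt_fst.comp w hasFDerivAt_snd
  have e3 : HasFDerivAt (fun w : KineticSpace d => w.2.2)
      ((ContinuousLinearMap.snd ℝ _ _).comp (ContinuousLinearMap.snd ℝ _ _)) w :=
    hasFDerivAt_snd.comp w hasFDerivAt_snd
  have hc := ((e1.const_mul a).const_add z.1).prodMk
    ((((e2.const_smul (a * b)).const_add z.2.1).add ((e1.const_mul a).smul_const z.2.2)).prodMk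
      ((e3.const_smul b).const_add z.2.2))
  have := (hψ (chart z a b w)).hasFDerivAt.comp w (f := chart z a b) hc
  rw [show (fun w => ψ (chart z a b w)) = ψ ∘ chart z a b from rfl, this.fderiv]
  simp

lemma integral_comp_chart_mul_partialV {f : KineticSpace d → ℝ} {G : KineticSpace d → Rd d}
    (h : HasWeakGradV f G) {φ : KineticSpace d → ℝ} (hφ : IsTestFunction φ)
    (z : KineticSpace d) {a b : ℝ} (ha : 0 < a) (hb : 0 < b) (i : Fin d) :
    ∫ w, f (chart z a b w) * partialV i φ w = -(b * ∫ w, G (chart z a b w) i * φ w) := by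
  set ψ : KineticSpace d → ℝ := fun y => φ (chartInv z a b y) with hψ_def
  have hψ : IsTestFunction ψ := isTestFunction_comp_chartInv hφ z ha hb
  have hφψ : φ = fun w => ψ (chart z a b w) := by
    funext w; simp only [hψ_def, chartInv_chart z ha hb]
  have hd : ∀ w, partialV i φ w = b * partialV i ψ (chart z a b w) := fun w => by
    unfold partialV
    rw [hφψ, fderiv_comp_chart (differentiable_of_isTestFunction hψ)]
    simp only [mul_zero, smul_zero, zero_smul, add_zero]
    rw [← smul_eq_mul, ← map_smul]
    simp
  calc ∫ w, f (chart z a b w) * partialV i φ w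
      = b * ∫ w, f (chart z a b w) * partialV i ψ (chart z a b w) := by
        rw [← integral_const_mul]
        refine integral_congr_ae (.of_forall fun w => ?_)
        simp only [hd]; ring
    _ = -(b * ∫ w, G (chart z a b w) i * ψ (chart z a b w)) := by
        rw [integral_comp_chart z ha hb (fun y => f y * partialV i ψ y), h.2.2 ψ hψ i,
          integral_comp_chart z ha hb (fun y => G y i * ψ y)]
        ring
    _ = _ := by rw [hφψ]

lemma integral_comp_chart_mul_transport {f : KineticSpace d → ℝ} {S : KineticSpace d → Rd d}
    (h : IsKineticSolution f S) {φ : KineticSpace d → ℝ} (hφ : IsTestFunction φ)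
    (z : KineticSpace d) {a b : ℝ} (ha : 0 < a) (hb : 0 < b) :
    ∫ w, f (chart z a b w) * transport φ w =
      a / b * ∫ w, ∑ i, S (chart z a b w) i * partialV i φ w := by
  set ψ : KineticSpace d → ℝ := fun y => φ (chartInv z a b y) with hψ_def
  have hψ : IsTestFunction ψ := isTestFunction_comp_chartInv hφ z ha hb
  have hφψ : φ = fun w => ψ (chart z a b w) := by
    funext w; simp only [hψ_def, chartInv_chart z ha hb]
  have hdψ := differentiable_of_isTestFunction hψ
  have hd : ∀ i w, partialV i φ w = b * partialV i ψ (chart z a b w) := fun i w => by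
    unfold partialV
    rw [hφψ, fderiv_comp_chart hdψ]
    simp only [mul_zero, smul_zero, zero_smul, add_zero]
    rw [← smul_eq_mul, ← map_smul]
    simp
  have ht : ∀ w, transport φ w = a * transport ψ (chart z a b w) := fun w => by
    unfold transport
    rw [hφψ, fderiv_comp_chart hdψ]
    have e : ((a * 1, (a * b) • w.2.2 + (a * 1) • z.2.2, b • 0) : KineticSpace d) =
        a • (1, (chart z a b w).2.2, 0) := by
      simp [chart, gmul, dil, smul_smul, add_comm]
    exact (congrArg _ e).trans (by rw [map_smul, smul_eq_mul])
  have hS := h.2.2 ψ hψ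
  calc ∫ w, f (chart z a b w) * transport φ w
      = a * ∫ w, f (chart z a b w) * transport ψ (chart z a b w) := by
        rw [← integral_const_mul]
        refine integral_congr_ae (.of_forall fun w => ?_)
        simp only [ht]; ring
    _ = a * ∫ w, ∑ i, S (chart z a b w) i * partialV i ψ (chart z a b w) := by
        rw [integral_comp_chart z ha hb (fun y => f y * transport ψ y), neg_inj.1 hS,
          integral_comp_chart z ha hb (fun y => ∑ i, S y i * partialV i ψ y)]
    _ = _ := by
        rw [← integral_const_mul, ← integral_const_mul]
        refine integral_congr_ae (.of_forall fun w => ?_)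
        simp only [hd, Finset.mul_sum]
        refine Finset.sum_congr rfl fun i _ => ?_
        field_simp

/-- The average of `f` around `z` at scale `(a, b)`, with weight `K`. -/
noncomputable def avg (f K : KineticSpace d → ℝ) (a b : ℝ) (z : KineticSpace d) : ℝ :=
  ∫ w, f (chart z a b w) * K w

lemma avg_eq (f K : KineticSpace d → ℝ) {a b : ℝ} (ha : 0 < a) (hb : 0 < b)
    (z : KineticSpace d) :
    avg f K a b z = ∫ y, f y * ((a ^ (d + 1) * b ^ (2 * d))⁻¹ * K (chartInv z a b y)) := by
  have := integral_comp_chart z ha hb (fun y => f y * K (chartInv z a b y))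
  simp only [chartInv_chart z ha hb] at this
  rw [avg, this, ← integral_const_mul]
  refine integral_congr_ae (.of_forall fun w => ?_)
  ring

/-- For the average of a kinetic solution the generator of the dilations turns into the velocity
gradient and the source. -/
lemma avg_dilGen {f : KineticSpace d → ℝ} {G S : KineticSpace d → Rd d} (hG : HasWeakGradV f G)
    (hS : IsKineticSolution f S) (κ : ℝ) {K : KineticSpace d → ℝ} (hK : IsTestFunction K)
    (z : KineticSpace d) {a b : ℝ} (ha : 0 < a) (hb : 0 < b) :
    avg f (dilGen κ K) a b z =
      -(b * ∑ i, ∫ w, G (chart z a b w) i * velField κ K i w) +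
        a / b * ∫ w, ∑ i, S (chart z a b w) i * partialV i (transField κ K) w := by
  have hA := isTestFunction_velField κ hK
  have hB := isTestFunction_transField κ hK
  simp only [avg, dilGen_eq κ hK, mul_add, Finset.mul_sum]
  rw [integral_add, integral_finsetSum, integral_comp_chart_mul_transport hS hB z ha hb]
  · rw [Finset.sum_congr rfl fun i _ => integral_comp_chart_mul_partialV hG (hA i) z ha hb i,
      Finset.sum_neg_distrib]
  · exact fun i _ => integrable_comp_chart_mul hG.1 (isTestFunction_partialV (hA i) i) z ha hb
  · exact integrable_finsetSum _ fun i _ =>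
      integrable_comp_chart_mul hG.1 (isTestFunction_partialV (hA i) i) z ha hb
  · exact integrable_comp_chart_mul hG.1 (isTestFunction_transport hB) z ha hb

/-- The time scale at logarithmic scale `τ`. The factors `c ^ (2 * d)` here and
`(c ^ (d + 1))⁻¹` in `velScale` are the one-parameter group of anisotropic scalings that preserves
the Jacobian of `dil`. -/
noncomputable def timeScale (d : ℕ) (c τ : ℝ) : ℝ := c ^ (2 * d) * Real.exp τ

/-- The velocity scale at logarithmic scale `τ`. -/
noncomputable def velScale (d : ℕ) (c κ τ : ℝ) : ℝ := (c ^ (d + 1))⁻¹ * Real.exp (κ * τ)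

lemma timeScale_pos (d : ℕ) {c : ℝ} (hc : 0 < c) (τ : ℝ) : 0 < timeScale d c τ := by
  unfold timeScale; positivity

lemma velScale_pos (d : ℕ) {c : ℝ} (hc : 0 < c) (κ τ : ℝ) : 0 < velScale d c κ τ := by
  unfold velScale; positivity

lemma jacobian_scale (d : ℕ) {c : ℝ} (hc : 0 < c) (κ τ : ℝ) :
    (timeScale d c τ ^ (d + 1) * velScale d c κ τ ^ (2 * d))⁻¹ =
      Real.exp (-((1 + d + 2 * d * κ) * τ)) := by
  unfold timeScale velScale
  rw [mul_pow, mul_pow, inv_pow, ← pow_mul, ← pow_mul, ← Real.exp_nat_mul, ← Real.exp_nat_mul,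
    mul_comm (d + 1) (2 * d), Real.exp_neg]
  congr 1
  rw [mul_mul_mul_comm, mul_inv_cancel₀ (by positivity), one_mul, ← Real.exp_add]
  congr 1
  push_cast; ring

lemma hasDerivAt_chartInv (d : ℕ) (c κ : ℝ) (z y : KineticSpace d) (τ : ℝ) :
    HasDerivAt (fun τ => chartInv z (timeScale d c τ) (velScale d c κ τ) y)
      (-(((chartInv z (timeScale d c τ) (velScale d c κ τ) y).1,
        (1 + κ) • (chartInv z (timeScale d c τ) (velScale d c κ τ) y).2.1,
        κ • (chartInv z (timeScale d c τ) (velScale d c κ τ) y).2.2) : KineticSpace d)) τ := by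
  have h1 : HasDerivAt (fun τ => (timeScale d c τ)⁻¹) (-(timeScale d c τ)⁻¹) τ := by
    have e : (fun τ => (timeScale d c τ)⁻¹) = fun τ => (c ^ (2 * d))⁻¹ * Real.exp (-τ) := by
      funext τ; rw [timeScale, mul_inv, Real.exp_neg]
    have := ((hasDerivAt_id τ).neg.exp).const_mul ((c ^ (2 * d))⁻¹)
    rw [e]
    convert! this using 1
    simp [timeScale, Real.exp_neg, mul_comm]
  have h2 : HasDerivAt (fun τ => (velScale d c κ τ)⁻¹) (-κ * (velScale d c κ τ)⁻¹) τ := by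
    have e : (fun τ => (velScale d c κ τ)⁻¹) = fun τ => c ^ (d + 1) * Real.exp (-(κ * τ)) := by
      funext τ; rw [velScale, mul_inv, Real.exp_neg, inv_inv]
    have := (((hasDerivAt_id τ).const_mul κ).neg.exp).const_mul (c ^ (d + 1))
    rw [e]
    convert! this using 1
    simp [velScale, Real.exp_neg]; ring
  have h3 := (h1.mul_const (gmul (ginv z) y).1).prodMk
    (((h1.mul h2).smul_const (gmul (ginv z) y).2.1).prodMk (h2.smul_const (gmul (ginv z) y).2.2))
  convert! h3 using 1
  simp only [chartInv, dil, Prod.neg_mk, Prod.mk.injEq]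
  refine ⟨by ring, by module, by module⟩

lemma continuous_timeScale (d : ℕ) (c : ℝ) : Continuous (timeScale d c) := by
  unfold timeScale; fun_prop

lemma continuous_velScale (d : ℕ) (c κ : ℝ) : Continuous (velScale d c κ) := by
  unfold velScale; fun_prop

lemma continuous_chart_scale (d : ℕ) (c κ : ℝ) : Continuous
    (fun q : ℝ × KineticSpace d × KineticSpace d =>
      chart q.2.1 (timeScale d c q.1) (velScale d c κ q.1) q.2.2) := by
  have h1 := continuous_timeScale d c
  have h2 := continuous_velScale d c κ
  unfold chart gmul dil
  fun_prop

/-- Differentiating an average of `f` with respect to the logarithmic scale replaces the weight `K`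
by `dilGen κ K`; no derivative falls on `f`. -/
lemma hasDerivAt_avg {f : KineticSpace d → ℝ} (hf : LocallyIntegrable f) {κ : ℝ} (hκ : 0 ≤ κ)
    {K : KineticSpace d → ℝ} (hK : IsTestFunction K) {c : ℝ} (hc : 0 < c) (z : KineticSpace d)
    (τ₀ : ℝ) :
    HasDerivAt (fun τ => avg f K (timeScale d c τ) (velScale d c κ τ) z)
      (avg f (dilGen κ K) (timeScale d c τ₀) (velScale d c κ τ₀) z) τ₀ := by
  have ha := timeScale_pos d hc
  have hb := velScale_pos d hc κ
  have hK' := isTestFunction_dilGen κ hK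
  simp only [avg_eq _ _ (ha _) (hb _), jacobian_scale d hc κ]
  set N : ℝ := 1 + d + 2 * d * κ with hN
  have hN0 : 0 ≤ N := by positivity
  -- all the supports for `|τ - τ₀| ≤ 1` lie in one compact set
  set Q : Set (KineticSpace d) :=
    (fun q : ℝ × KineticSpace d => chart z (timeScale d c q.1) (velScale d c κ q.1) q.2) ''
      (Set.Icc (τ₀ - 1) (τ₀ + 1) ×ˢ tsupport (dilGen κ K)) with hQ
  have hQc : IsCompact Q := by
    refine (isCompact_Icc.prod hK'.2).image ?_
    exact (continuous_chart_scale d c κ).comp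
      (f := fun q : ℝ × KineticSpace d => (q.1, z, q.2)) (by fun_prop)
  obtain ⟨M, hM⟩ := hK'.2.exists_bound_of_continuous hK'.1.continuous
  have hM0 : 0 ≤ M := (norm_nonneg _).trans (hM 0)
  have hint : ∀ τ, ∀ φ : KineticSpace d → ℝ, IsTestFunction φ → Integrable (fun y => f y *
      (Real.exp (-(N * τ)) * φ (chartInv z (timeScale d c τ) (velScale d c κ τ) y))) := by
    intro τ φ hφ
    have hφ' := isTestFunction_mul (isTestFunction_comp_chartInv hφ z (ha τ) (hb τ))
      (g := fun _ => Real.exp (-(N * τ))) contDiff_const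
    exact integrable_mul_of_locallyIntegrable hf hφ'.1.continuous hφ'.2
  refine (hasDerivAt_integral_of_dominated_loc_of_deriv_le
    (s := Metric.ball τ₀ 1)
    (bound := Q.indicator fun y => ‖f y‖ * (Real.exp (-(N * (τ₀ - 1))) * M))
    (F' := fun τ y => f y *
      (Real.exp (-(N * τ)) * dilGen κ K (chartInv z (timeScale d c τ) (velScale d c κ τ) y)))
    (Metric.ball_mem_nhds τ₀ one_pos) ?_ (hint τ₀ K hK) (hint τ₀ _ hK').1 ?_ ?_ ?_).2
  · exact .of_forall fun τ => (hint τ K hK).1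
  · refine .of_forall fun y τ hτ => ?_
    rw [Metric.mem_ball, Real.dist_eq, abs_lt] at hτ
    by_cases hy : dilGen κ K (chartInv z (timeScale d c τ) (velScale d c κ τ) y) = 0
    · rw [hy, mul_zero, mul_zero, norm_zero]
      exact Set.indicator_nonneg (fun _ _ => by positivity) _
    have hyQ : y ∈ Q := by
      refine ⟨(τ, chartInv z (timeScale d c τ) (velScale d c κ τ) y), ⟨⟨?_, ?_⟩, ?_⟩, ?_⟩
      · linarith
      · linarith
      · exact subset_tsupport _ hy
      · exact chart_chartInv z (ha τ) (hb τ) y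
    rw [Set.indicator_of_mem hyQ, norm_mul, norm_mul, Real.norm_eq_abs (Real.exp _),
      abs_of_pos (Real.exp_pos _)]
    gcongr
    · linarith
    · exact hM _
  · rw [integrable_indicator_iff hQc.measurableSet]
    exact ((hf.integrableOn_isCompact hQc).norm).mul_const _
  · refine .of_forall fun y τ _ => ?_
    refine HasDerivAt.const_mul _ ?_
    have h1 : HasDerivAt (fun τ => Real.exp (-(N * τ))) (-N * Real.exp (-(N * τ))) τ := by
      have := ((hasDerivAt_id τ).const_mul N).neg.exp
      convert! this using 1
      simp; ring
    have h2 := ((differentiable_of_isTestFunction hK _).hasFDerivAt.comp_hasDerivAt τ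
      (hasDerivAt_chartInv d c κ z y τ))
    convert! h1.mul h2 using 1
    simp only [dilGen, map_neg, Function.comp_apply]
    rw [← hN]
    ring

/-! ### Bounds and limits of the averages -/

lemma exists_enorm_le_of_isTestFunction {φ : KineticSpace d → ℝ} (hφ : IsTestFunction φ) :
    ∃ M : ℝ≥0∞, M ≠ ⊤ ∧ ∀ z, ‖φ z‖ₑ ≤ M := by
  obtain ⟨M, hM⟩ := hφ.2.exists_bound_of_continuous hφ.1.continuous
  refine ⟨ENNReal.ofReal M, ENNReal.ofReal_ne_top, fun z => ?_⟩
  rw [← ofReal_norm]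
  exact ENNReal.ofReal_le_ofReal (hM z)

lemma enorm_coord_le (x : Rd d) (i : Fin d) : ‖x i‖ₑ ≤ ‖x‖ₑ := by
  rw [← ofReal_norm, ← ofReal_norm]
  exact ENNReal.ofReal_le_ofReal (PiLp.norm_apply_le x i)

lemma enorm_mul_le_indicator {φ : KineticSpace d → ℝ} {Q : Set (KineticSpace d)}
    (hQ : tsupport φ ⊆ Q) {M : ℝ≥0∞} (hM : ∀ z, ‖φ z‖ₑ ≤ M) (x : ℝ) {y : ℝ≥0∞} (hxy : ‖x‖ₑ ≤ y)
    (w : KineticSpace d) : ‖x * φ w‖ₑ ≤ Q.indicator (fun _ => M * y) w := by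
  by_cases hw : φ w = 0
  · simp [hw]
  · rw [Set.indicator_of_mem (hQ (subset_tsupport _ hw)), enorm_mul, mul_comm]
    gcongr
    exact hM w

lemma enorm_avg_le {f K : KineticSpace d → ℝ} {Q : Set (KineticSpace d)} (hQm : MeasurableSet Q)
    (hQ : tsupport K ⊆ Q) {M : ℝ≥0∞} (hMt : M ≠ ⊤) (hM : ∀ z, ‖K z‖ₑ ≤ M) (a b : ℝ)
    (z : KineticSpace d) :
    ‖avg f K a b z‖ₑ ≤ M * ∫⁻ w in Q, ‖f (chart z a b w)‖ₑ := by
  calc ‖avg f K a b z‖ₑ ≤ ∫⁻ w, ‖f (chart z a b w) * K w‖ₑ := enorm_integral_le_lintegral_enorm _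
    _ ≤ ∫⁻ w, Q.indicator (fun w => M * ‖f (chart z a b w)‖ₑ) w :=
        lintegral_mono fun w => enorm_mul_le_indicator hQ hM _ le_rfl w
    _ = _ := by
        rw [lintegral_indicator hQm, lintegral_const_mul' _ _ hMt]

/-- The two averages that control the derivative of `avg f K` with respect to the logarithmic
scale `τ`. -/
noncomputable def scaleDensity (G S : KineticSpace d → Rd d) (Q : Set (KineticSpace d))
    (c κ τ : ℝ) (z : KineticSpace d) : ℝ≥0∞ :=
  ENNReal.ofReal (velScale d c κ τ) *
      (∫⁻ w in Q, ‖G (chart z (timeScale d c τ) (velScale d c κ τ) w)‖ₑ) +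
    ENNReal.ofReal (timeScale d c τ / velScale d c κ τ) *
      ∫⁻ w in Q, ‖S (chart z (timeScale d c τ) (velScale d c κ τ) w)‖ₑ

lemma exists_enorm_avg_dilGen_le (κ : ℝ) {K : KineticSpace d → ℝ} (hK : IsTestFunction K) :
    ∃ (Q : Set (KineticSpace d)) (M : ℝ≥0∞), IsCompact Q ∧ M ≠ ⊤ ∧
      ∀ (f : KineticSpace d → ℝ) (G S : KineticSpace d → Rd d), HasWeakGradV f G →
        IsKineticSolution f S → ∀ c : ℝ, 0 < c → ∀ τ z,
          ‖avg f (dilGen κ K) (timeScale d c τ) (velScale d c κ τ) z‖ₑ ≤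
            M * scaleDensity G S Q c κ τ z := by
  have hA := isTestFunction_velField κ hK
  have hB := fun i => isTestFunction_partialV (isTestFunction_transField κ hK) i
  choose MA hMAt hMA using fun i => exists_enorm_le_of_isTestFunction (hA i)
  choose MB hMBt hMB using fun i => exists_enorm_le_of_isTestFunction (hB i)
  set Q := (⋃ i, tsupport (velField κ K i)) ∪
    ⋃ i, tsupport (partialV i (transField κ K)) with hQ
  have hQc : IsCompact Q :=
    (isCompact_iUnion fun i => (hA i).2).union (isCompact_iUnion fun i => (hB i).2)
  have hQm : MeasurableSet Q := hQc.measurableSet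
  have hQA : ∀ i, tsupport (velField κ K i) ⊆ Q := fun i x hx =>
    Or.inl (Set.mem_iUnion.2 ⟨i, hx⟩)
  have hQB : ∀ i, tsupport (partialV i (transField κ K)) ⊆ Q := fun i x hx =>
    Or.inr (Set.mem_iUnion.2 ⟨i, hx⟩)
  have hSA : ∑ i, MA i ≠ ⊤ := by simp [ENNReal.sum_eq_top, hMAt]
  have hSB : ∑ i, MB i ≠ ⊤ := by simp [ENNReal.sum_eq_top, hMBt]
  refine ⟨Q, ∑ i, MA i + ∑ i, MB i, hQc,
    ENNReal.add_ne_top.2 ⟨hSA, hSB⟩, ?_⟩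
  intro f G S hG hS c hc τ z
  have ha := timeScale_pos d hc τ
  have hb := velScale_pos d hc κ τ
  rw [avg_dilGen hG hS κ hK z ha hb, scaleDensity, mul_add]
  set a := timeScale d c τ
  set b := velScale d c κ τ
  refine (enorm_add_le _ _).trans (add_le_add ?_ ?_)
  · rw [enorm_neg, enorm_mul, Real.enorm_of_nonneg hb.le, mul_left_comm]
    gcongr
    calc ‖∑ i, ∫ w, G (chart z a b w) i * velField κ K i w‖ₑ
        ≤ ∑ i, ‖∫ w, G (chart z a b w) i * velField κ K i w‖ₑ := enorm_sum_le _ _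
      _ ≤ ∑ i, MA i * ∫⁻ w in Q, ‖G (chart z a b w)‖ₑ := by
          refine Finset.sum_le_sum fun i _ => ?_
          calc _ ≤ ∫⁻ w, ‖G (chart z a b w) i * velField κ K i w‖ₑ :=
                enorm_integral_le_lintegral_enorm _
            _ ≤ ∫⁻ w, Q.indicator (fun w => MA i * ‖G (chart z a b w)‖ₑ) w :=
                lintegral_mono fun w =>
                  enorm_mul_le_indicator (hQA i) (hMA i) _ (enorm_coord_le _ i) w
            _ = _ := by rw [lintegral_indicator hQm, lintegral_const_mul' _ _ (hMAt i)]
      _ ≤ _ := by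
          rw [← Finset.sum_mul]
          gcongr
          exact le_self_add
  · rw [enorm_mul, Real.enorm_of_nonneg (div_pos ha hb).le, mul_left_comm]
    gcongr
    calc ‖∫ w, ∑ i, S (chart z a b w) i * partialV i (transField κ K) w‖ₑ
        ≤ ∫⁻ w, ‖∑ i, S (chart z a b w) i * partialV i (transField κ K) w‖ₑ :=
          enorm_integral_le_lintegral_enorm _
      _ ≤ ∫⁻ w, Q.indicator (fun w => (∑ i, MB i) * ‖S (chart z a b w)‖ₑ) w := by
          refine lintegral_mono fun w => (enorm_sum_le _ _).trans ?_
          refine (Finset.sum_le_sum fun i _ =>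
            enorm_mul_le_indicator (hQB i) (hMB i) _ (enorm_coord_le _ i) w).trans ?_
          by_cases hw : w ∈ Q
          · simp only [Set.indicator_of_mem hw, Finset.sum_mul, le_refl]
          · simp only [Set.indicator_of_notMem hw, Finset.sum_const_zero, le_refl]
      _ = (∑ i, MB i) * ∫⁻ w in Q, ‖S (chart z a b w)‖ₑ := by
          rw [lintegral_indicator hQm, lintegral_const_mul' _ _ hSB]
      _ ≤ _ := by gcongr; exact le_add_self

/-- Averages of an `L^2` function tend to zero at large scales. -/
lemma tendsto_avg_atTop {f : KineticSpace d → ℝ} (hfm : Measurable f) (hf : MemLp f 2)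
    {K : KineticSpace d → ℝ} (hK : IsTestFunction K) {c κ : ℝ} (hc : 0 < c) (hκ : 0 ≤ κ)
    (z : KineticSpace d) :
    Filter.Tendsto (fun τ => avg f K (timeScale d c τ) (velScale d c κ τ) z) Filter.atTop
      (nhds 0) := by
  obtain ⟨M, hMt, hM⟩ := exists_enorm_le_of_isTestFunction hK
  set N : ℝ := 1 + d + 2 * d * κ with hN
  have hN0 : 0 < N := by positivity
  have hf2 : ∫⁻ y, ‖f y‖ₑ ^ (2 : ℝ) < ⊤ := by
    have := lintegral_rpow_enorm_lt_top_of_eLpNorm_lt_top two_ne_zero ENNReal.ofNat_ne_top hf.2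
    simpa using this
  set I : ℝ := (∫⁻ y, ‖f y‖ₑ ^ (2 : ℝ)).toReal with hI
  have hQf : volume (tsupport K) ≠ ⊤ := hK.2.isCompact.measure_lt_top.ne
  have hle : ∀ τ, ‖avg f K (timeScale d c τ) (velScale d c κ τ) z‖ₑ ≤
      M * ((volume (tsupport K) + ENNReal.ofReal I) *
        ENNReal.ofReal (Real.exp (-(N * τ) / 2))) := by
    intro τ
    have ha := timeScale_pos d hc τ
    have hb := velScale_pos d hc κ τ
    refine (enorm_avg_le (isClosed_tsupport K).measurableSet le_rfl hMt hM _ _ z).trans ?_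
    gcongr
    have hm : Measurable fun w => ‖f (chart z (timeScale d c τ) (velScale d c κ τ) w)‖ₑ :=
      (hfm.comp (contDiff_chart z _ _).continuous.measurable).enorm
    refine setLIntegral_le_of_lintegral_rpow_le (p := 2) one_le_two hm
      ENNReal.toReal_nonneg (le_of_eq ?_)
    rw [lintegral_comp_chart z ha hb (H := fun y => ‖f y‖ₑ ^ (2 : ℝ)) (by fun_prop),
      jacobian_scale d hc κ, mul_comm, ENNReal.ofReal_mul ENNReal.toReal_nonneg,
      ENNReal.ofReal_toReal hf2.ne]
    congr 3
    ring
  have hlim : Filter.Tendsto (fun τ : ℝ => M * ((volume (tsupport K) + ENNReal.ofReal I) *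
      ENNReal.ofReal (Real.exp (-(N * τ) / 2)))) Filter.atTop (nhds 0) := by
    have h1 : Filter.Tendsto (fun τ : ℝ => Real.exp (-(N * τ) / 2)) Filter.atTop (nhds 0) := by
      refine Real.tendsto_exp_atBot.comp ?_
      have := (Filter.tendsto_id (α := ℝ) (x := Filter.atTop)).const_mul_atTop
        (show 0 < N / 2 by positivity)
      refine (Filter.tendsto_neg_atTop_atBot.comp this).congr fun τ => ?_
      simp; ring
    have h2 := ENNReal.tendsto_ofReal h1
    have h3 := ENNReal.Tendsto.const_mul (a := M) (ENNReal.Tendsto.const_mul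
      (a := volume (tsupport K) + ENNReal.ofReal I) h2 (Or.inr (by simp [hQf]))) (Or.inr hMt)
    simpa using h3
  rw [tendsto_zero_iff_enorm_tendsto_zero]
  exact tendsto_of_tendsto_of_tendsto_of_le_of_le tendsto_const_nhds hlim (fun _ => zero_le) hle

/-- Integrating the derivative from the scale `τ₀` to infinity bounds the average. -/
lemma enorm_avg_le_lintegral {f : KineticSpace d → ℝ} (hfm : Measurable f) (hf : MemLp f 2)
    (hfl : LocallyIntegrable f) {K : KineticSpace d → ℝ} (hK : IsTestFunction K) {c κ : ℝ}
    (hc : 0 < c) (hκ : 0 ≤ κ) (z : KineticSpace d) (τ₀ : ℝ) :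
    ‖avg f K (timeScale d c τ₀) (velScale d c κ τ₀) z‖ₑ ≤
      ∫⁻ τ, ‖avg f (dilGen κ K) (timeScale d c τ) (velScale d c κ τ) z‖ₑ := by
  set F : ℝ → ℝ := fun τ => avg f K (timeScale d c τ) (velScale d c κ τ) z with hF
  set F' : ℝ → ℝ := fun τ => avg f (dilGen κ K) (timeScale d c τ) (velScale d c κ τ) z with hF'
  have hd : ∀ τ, HasDerivAt F (F' τ) τ := fun τ => hasDerivAt_avg hfl hκ hK hc z τ
  have hcont : Continuous F' := by
    refine continuous_iff_continuousAt.2 fun τ => ?_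
    exact (hasDerivAt_avg hfl hκ (isTestFunction_dilGen κ hK) hc z τ).continuousAt
  have hdiff : ∀ τ₁, τ₀ ≤ τ₁ → ‖F τ₁ - F τ₀‖ₑ ≤ ∫⁻ τ, ‖F' τ‖ₑ := by
    intro τ₁ h
    rw [← intervalIntegral.integral_eq_sub_of_hasDerivAt (fun τ _ => hd τ)
      (hcont.intervalIntegrable _ _), intervalIntegral.integral_of_le h]
    exact (enorm_integral_le_lintegral_enorm _).trans (setLIntegral_le_lintegral _ _)
  have hlim : Filter.Tendsto (fun τ₁ => ‖F τ₁ - F τ₀‖ₑ) Filter.atTop (nhds ‖0 - F τ₀‖ₑ) :=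
    ((tendsto_avg_atTop hfm hf hK hc hκ z).sub_const _).enorm
  rw [zero_sub, enorm_neg] at hlim
  exact le_of_tendsto hlim (Filter.eventually_ge_atTop τ₀ |>.mono hdiff)

lemma tendsto_eLpNorm_gmul_sub {f : KineticSpace d → ℝ} (hf : MemLp f 2) :
    Filter.Tendsto (fun u : KineticSpace d => eLpNorm (fun z => f (gmul z u) - f z) 2 volume)
      (nhds 0) (nhds 0) := by
  let g : C(KineticSpace d, C(KineticSpace d, KineticSpace d)) :=
    ContinuousMap.curry ⟨fun q : KineticSpace d × KineticSpace d => gmul q.2 q.1, by fun_prop⟩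
  have hg : ∀ u, MeasurePreserving (g u) (volume : Measure (KineticSpace d)) volume :=
    fun u => measurePreserving_gmul_right u
  have hcont : Continuous fun u => Lp.compMeasurePreserving (g u) (hg u) (hf.toLp f) :=
    continuous_const.compMeasurePreservingLp g.continuous hg ENNReal.ofNat_ne_top
  have h0 := (tendsto_iff_edist_tendsto_0.1 (hcont.tendsto 0))
  refine h0.congr fun u => ?_
  rw [Lp.toLp_compMeasurePreserving hf, Lp.toLp_compMeasurePreserving hf, Lp.edist_toLp_toLp]
  congr 1
  funext z
  simp [g, gmul_zero]

/-- At small scales the averages of an `L^2` function converge to it, tested against `L^2`. -/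
lemma tendsto_lintegral_avg_sub_atBot {f : KineticSpace d → ℝ} (hfm : Measurable f)
    (hf : MemLp f 2) (hfl : LocallyIntegrable f) {K : KineticSpace d → ℝ} (hK : IsTestFunction K)
    (hK1 : ∫ w, K w = 1) {c κ : ℝ} (hc : 0 < c) (hκ : 0 < κ) {k : KineticSpace d → ℝ≥0∞}
    (hk : Measurable k) (hk2 : ∫⁻ z, k z ^ (2 : ℝ) ≠ ⊤) :
    Filter.Tendsto (fun τ => ∫⁻ z, ‖avg f K (timeScale d c τ) (velScale d c κ τ) z - f z‖ₑ * k z)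
      Filter.atBot (nhds 0) := by
  set D : KineticSpace d → ℝ≥0∞ := fun u => eLpNorm (fun z => f (gmul z u) - f z) 2 volume with hD
  set u : ℝ → KineticSpace d → KineticSpace d :=
    fun τ w => dil (timeScale d c τ) (velScale d c κ τ) w with hu
  set B : ℝ≥0∞ := (∫⁻ z, k z ^ (2 : ℝ)) ^ (1 / (2 : ℝ)) with hB
  have hBt : B ≠ ⊤ := ENNReal.rpow_ne_top_of_nonneg (by norm_num) hk2
  have hDeq : ∀ u, D u = (∫⁻ z, ‖f (gmul z u) - f z‖ₑ ^ (2 : ℝ)) ^ (1 / (2 : ℝ)) := fun u => by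
    rw [hD]; dsimp only
    rw [eLpNorm_eq_lintegral_rpow_enorm_toReal two_ne_zero ENNReal.ofNat_ne_top]
    simp
  have hjm : Measurable (fun q : KineticSpace d × KineticSpace d => f (gmul q.2 q.1) - f q.2) :=
    (hfm.comp (Continuous.measurable (by fun_prop))).sub (hfm.comp measurable_snd)
  have hDm : Measurable D := by
    simp only [funext hDeq]
    refine Measurable.pow_const (Measurable.lintegral_prod_right'
      (f := fun q : KineticSpace d × KineticSpace d => ‖f (gmul q.2 q.1) - f q.2‖ₑ ^ (2 : ℝ)) ?_) _
    fun_prop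
  have hDle : ∀ u, D u ≤ 2 * eLpNorm f 2 volume := fun u => by
    have h1 : MemLp (fun z => f (gmul z u)) 2 volume :=
      hf.comp_measurePreserving (measurePreserving_gmul_right u)
    refine (eLpNorm_sub_le h1.1 hf.1 one_le_two).trans ?_
    rw [two_mul]
    gcongr
    exact (eLpNorm_comp_measurePreserving hf.1 (measurePreserving_gmul_right u)).le
  have hum : ∀ τ, Continuous (u τ) := fun τ => by rw [hu]; unfold dil; fun_prop
  have hulim : ∀ w, Filter.Tendsto (fun τ => u τ w) Filter.atBot (nhds 0) := by
    intro w
    have h1 : Filter.Tendsto (timeScale d c) Filter.atBot (nhds 0) := by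
      unfold timeScale
      simpa using Real.tendsto_exp_atBot.const_mul (c ^ (2 * d))
    have h2 : Filter.Tendsto (velScale d c κ) Filter.atBot (nhds 0) := by
      unfold velScale
      have := (Real.tendsto_exp_atBot.comp (Filter.tendsto_id.const_mul_atBot hκ)).const_mul
        ((c ^ (d + 1))⁻¹)
      simpa using this
    have h3 := (h1.mul_const w.1).prodMk_nhds
      (((h1.mul h2).smul_const w.2.1).prodMk_nhds (h2.smul_const w.2.2))
    simp only [mul_zero, zero_mul, zero_smul] at h3
    exact h3
  have hKt : ∫⁻ w, ‖K w‖ₑ ≠ ⊤ :=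
    (hK.1.continuous.integrable_of_hasCompactSupport hK.2).2.ne
  -- Minkowski's inequality in `w` and the Cauchy–Schwarz inequality in `z`
  have hle : ∀ τ, ∫⁻ z, ‖avg f K (timeScale d c τ) (velScale d c κ τ) z - f z‖ₑ * k z ≤
      ∫⁻ w, ‖K w‖ₑ * D (u τ w) * B := by
    intro τ
    have ha := timeScale_pos d hc τ
    have hb := velScale_pos d hc κ τ
    have hm : Measurable (fun q : KineticSpace d × KineticSpace d =>
        f (gmul q.1 (u τ q.2)) - f q.1) :=
      hjm.comp (((hum τ).measurable.comp measurable_snd).prodMk measurable_fst)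
    have hKm := hK.1.continuous.measurable
    calc ∫⁻ z, ‖avg f K (timeScale d c τ) (velScale d c κ τ) z - f z‖ₑ * k z
        ≤ ∫⁻ z, ∫⁻ w, ‖K w‖ₑ * (‖f (gmul z (u τ w)) - f z‖ₑ * k z) := by
          refine lintegral_mono fun z => ?_
          have e : avg f K (timeScale d c τ) (velScale d c κ τ) z - f z =
              ∫ w, K w * (f (gmul z (u τ w)) - f z) := by
            have h1 : ∫ w, f z * K w = f z := by rw [integral_const_mul, hK1, mul_one]
            have h2 := integrable_comp_chart_mul hfl hK z ha hb
            have h3 := (hK.1.continuous.integrable_of_hasCompactSupport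
              (μ := volume) hK.2).const_mul (f z)
            conv_lhs => rw [← h1, avg, ← integral_sub h2 h3]
            refine integral_congr_ae (.of_forall fun w => ?_)
            simp only [hu, chart]; ring
          have h4 : Measurable (fun w => ‖K w‖ₑ * ‖f (gmul z (u τ w)) - f z‖ₑ) :=
            hKm.enorm.mul (hm.comp (measurable_prodMk_left (x := z))).enorm
          rw [e]
          calc _ ≤ (∫⁻ w, ‖K w * (f (gmul z (u τ w)) - f z)‖ₑ) * k z := by
                gcongr; exact enorm_integral_le_lintegral_enorm _
            _ = _ := by
                simp only [enorm_mul, ← mul_assoc]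
                rw [lintegral_mul_const _ h4]
      _ = ∫⁻ w, ∫⁻ z, ‖K w‖ₑ * (‖f (gmul z (u τ w)) - f z‖ₑ * k z) := by
          rw [lintegral_lintegral_swap]
          exact ((hKm.comp measurable_snd).enorm.mul
            (hm.enorm.mul (hk.comp measurable_fst))).aemeasurable
      _ ≤ _ := by
          refine lintegral_mono fun w => ?_
          have h5 : Measurable (fun z => f (gmul z (u τ w)) - f z) :=
            hm.comp (measurable_prodMk_right (y := w))
          rw [lintegral_const_mul' _ _ enorm_ne_top, mul_assoc, hDeq, hB]
          gcongr
          exact ENNReal.lintegral_mul_le_Lp_mul_Lq volume Real.HolderConjugate.two_two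
            h5.enorm.aemeasurable hk.aemeasurable
  have hlim : Filter.Tendsto (fun τ => ∫⁻ w, ‖K w‖ₑ * D (u τ w) * B) Filter.atBot
      (nhds (∫⁻ _ : KineticSpace d, 0)) := by
    refine tendsto_lintegral_filter_of_dominated_convergence
      (fun w => ‖K w‖ₑ * (2 * eLpNorm f 2 volume) * B) ?_ ?_ ?_ ?_
    · exact .of_forall fun τ => (hK.1.continuous.measurable.enorm.mul
        (hDm.comp (hum τ).measurable)).mul_const _
    · refine .of_forall fun τ => .of_forall fun w => ?_
      gcongr
      exact hDle _
    · simp only [mul_assoc]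
      rw [lintegral_mul_const' _ _ (by finiteness [hf.2.ne])]
      exact ENNReal.mul_ne_top hKt (by finiteness [hf.2.ne])
    · refine .of_forall fun w => ?_
      have h1 := (tendsto_eLpNorm_gmul_sub hf).comp (hulim w)
      have h2 := ENNReal.Tendsto.mul_const (ENNReal.Tendsto.const_mul (a := ‖K w‖ₑ) h1
        (Or.inr enorm_ne_top)) (Or.inr hBt)
      simpa using h2
  rw [lintegral_zero] at hlim
  exact tendsto_of_tendsto_of_tendsto_of_le_of_le tendsto_const_nhds hlim (fun _ => zero_le) hle

/-! ### Potential estimates on the kinetic space -/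

/-- The trilinear Hardy–Littlewood–Sobolev inequality for the charts of `ℝ^{1+2d}`. The constant
does not depend on `c`, because `c` does not enter the Jacobian. -/
lemma exists_form_le (d : ℕ) {κ α p s : ℝ} (hκ : 0 ≤ κ) (hα : 0 < α) (hp : 1 < p) (hs : 1 < s)
    (hps : 1 / p + 1 / s = 1 + α / (1 + d + 2 * d * κ)) {Q : Set (KineticSpace d)}
    (hQ : volume Q ≠ ⊤) :
    ∃ C : ℝ≥0∞, C ≠ ⊤ ∧ ∀ c : ℝ, 0 < c → ∀ h k : KineticSpace d → ℝ≥0∞, Measurable h →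
      Measurable k → (∀ z, h z ≠ ⊤) → (∀ z, k z ≠ ⊤) → ∀ A B : ℝ≥0∞, A ≠ 0 → A ≠ ⊤ → B ≠ 0 →
        B ≠ ⊤ → ∫⁻ z, h z ^ p ≤ A ^ p → ∫⁻ z, k z ^ s ≤ B ^ s →
        ∫⁻ τ : ℝ, ENNReal.ofReal (Real.exp (α * τ)) * ∫⁻ z, k z *
          ∫⁻ w in Q, h (chart z (timeScale d c τ) (velScale d c κ τ) w) ≤ C * A * B := by
  have hN : 0 < 1 + (d : ℝ) + 2 * d * κ := by positivity
  obtain ⟨C, hC, H⟩ := exists_hardyLittlewoodSobolev hN hα hp hs hps hQ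
  refine ⟨C, hC, ?_⟩
  intro c hc h k hh hk hht hkt A B hA0 hAt hB0 hBt hhA hkB
  have hdilc : Continuous (fun q : ℝ × KineticSpace d × KineticSpace d =>
      dil (timeScale d c q.1) (velScale d c κ q.1) q.2.2) := by
    have h1 := continuous_timeScale d c
    have h2 := continuous_velScale d c κ
    unfold dil
    fun_prop
  have hΨc : Continuous (fun q : ℝ × KineticSpace d × KineticSpace d =>
      gmul q.2.1 (ginv (dil (timeScale d c q.1) (velScale d c κ q.1) q.2.2))) := by
    fun_prop
  have hnorm : ∀ (g : KineticSpace d → ℝ≥0∞) (r : ℝ) (D : ℝ≥0∞), 1 < r → Measurable g →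
      D ≠ 0 → D ≠ ⊤ → ∫⁻ z, g z ^ r ≤ D ^ r → ∫⁻ z, (D⁻¹ * g z) ^ r ≤ 1 := by
    intro g r D hr hg hD0 hDt hgD
    have hr0 : 0 ≤ r := by linarith
    calc ∫⁻ z, (D⁻¹ * g z) ^ r = (D ^ r)⁻¹ * ∫⁻ z, g z ^ r := by
          rw [← lintegral_const_mul _ (by fun_prop)]
          refine lintegral_congr fun z => ?_
          rw [ENNReal.mul_rpow_of_nonneg _ _ hr0, ENNReal.inv_rpow]
      _ ≤ (D ^ r)⁻¹ * D ^ r := by gcongr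
      _ ≤ 1 := ENNReal.inv_mul_le_one _
  have key := H (fun τ z w => chart z (timeScale d c τ) (velScale d c κ τ) w)
    (fun τ y w => gmul y (ginv (dil (timeScale d c τ) (velScale d c κ τ) w)))
    (continuous_chart_scale d c κ).measurable hΨc.measurable ?_ ?_
    (fun τ w => measurePreserving_gmul_right _) (fun τ w z => gmul_ginv_cancel _ _)
    (fun z => A⁻¹ * h z) (fun z => B⁻¹ * k z) (by fun_prop) (by fun_prop)
    (fun z => ENNReal.mul_ne_top (ENNReal.inv_ne_top.2 hA0) (hht z))
    (fun z => ENNReal.mul_ne_top (ENNReal.inv_ne_top.2 hB0) (hkt z))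
    (hnorm h p A hp hh hA0 hAt hhA) (hnorm k s B hs hk hB0 hBt hkB)
  · calc _ = A * B * ∫⁻ τ : ℝ, ENNReal.ofReal (Real.exp (α * τ)) * ∫⁻ z, B⁻¹ * k z *
          ∫⁻ w in Q, A⁻¹ * h (chart z (timeScale d c τ) (velScale d c κ τ) w) := by
          rw [← lintegral_const_mul' _ _ (ENNReal.mul_ne_top hAt hBt)]
          refine lintegral_congr fun τ => ?_
          rw [mul_left_comm, ← lintegral_const_mul' _ _ (ENNReal.mul_ne_top hAt hBt)]
          congr 1
          refine lintegral_congr fun z => ?_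
          rw [lintegral_const_mul' _ _ (ENNReal.inv_ne_top.2 hA0)]
          rw [show ∀ x : ℝ≥0∞, A * B * (B⁻¹ * k z * (A⁻¹ * x)) =
            A * A⁻¹ * (B * B⁻¹) * (k z * x) from fun x => by ring,
            ENNReal.mul_inv_cancel hA0 hAt, ENNReal.mul_inv_cancel hB0 hBt, one_mul, one_mul]
      _ ≤ A * B * C := by gcongr
      _ = _ := by ring
  · intro τ z H hH
    rw [lintegral_comp_chart z (timeScale_pos d hc τ) (velScale_pos d hc κ τ) hH,
      jacobian_scale d hc]
  · intro τ z H hH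
    rw [lintegral_comp_dil (timeScale_pos d hc τ) (velScale_pos d hc κ τ)
      (H := fun u => H (gmul z (ginv u))) (hH.comp (Continuous.measurable (by fun_prop))),
      jacobian_scale d hc]
    congr 1
    have h1 := measurePreserving_gmul_left z
    have h2 := (h1.comp measurePreserving_ginv).lintegral_comp hH
    exact h2

lemma exists_bump (d : ℕ) : ∃ K : KineticSpace d → ℝ, IsTestFunction K ∧ ∫ w, K w = 1 := by
  have : (volume : Measure (Rd d × Rd d)).IsAddHaarMeasure :=
    Measure.prod.instIsAddHaarMeasure volume volume
  have : (volume : Measure (KineticSpace d)).IsAddHaarMeasure :=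
    Measure.prod.instIsAddHaarMeasure volume volume
  let φ : ContDiffBump (0 : KineticSpace d) := ⟨1, 2, one_pos, one_lt_two⟩
  exact ⟨φ.normed volume, ⟨φ.contDiff_normed, φ.hasCompactSupport_normed⟩, φ.integral_normed⟩

/-- The representation of `f` as a potential of the two driving terms, tested against `k`: the bound
at the scale `τ` does not depend on `τ`, and the average at that scale tends to `f` as
`τ → -∞`. -/
lemma lintegral_enorm_mul_le {f : KineticSpace d → ℝ} {G S : KineticSpace d → Rd d}
    (hfm : Measurable f) (hf : MemLp f 2) (hfl : LocallyIntegrable f)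
    {K : KineticSpace d → ℝ} (hK : IsTestFunction K) (hK1 : ∫ w, K w = 1) {κ : ℝ} (hκ : 0 < κ)
    {Q : Set (KineticSpace d)} {M : ℝ≥0∞} (hMt : M ≠ ⊤) {c : ℝ} (hc : 0 < c)
    (hM : ∀ τ z, ‖avg f (dilGen κ K) (timeScale d c τ) (velScale d c κ τ) z‖ₑ ≤
      M * scaleDensity G S Q c κ τ z) {k : KineticSpace d → ℝ≥0∞} (hk : Measurable k)
    (hk2 : ∫⁻ z, k z ^ (2 : ℝ) ≠ ⊤) :
    ∫⁻ z, ‖f z‖ₑ * k z ≤ M * ∫⁻ z, (∫⁻ τ, scaleDensity G S Q c κ τ z) * k z := by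
  have h1 : ∀ τ, ∫⁻ z, ‖f z‖ₑ * k z ≤
      M * (∫⁻ z, (∫⁻ τ, scaleDensity G S Q c κ τ z) * k z) +
      ∫⁻ z, ‖avg f K (timeScale d c τ) (velScale d c κ τ) z - f z‖ₑ * k z := by
    intro τ
    rw [← lintegral_const_mul' _ _ hMt]
    have hmeas : Measurable fun z => ‖avg f K (timeScale d c τ) (velScale d c κ τ) z - f z‖ₑ
        * k z := by
      have h2 : StronglyMeasurable (fun z => avg f K (timeScale d c τ) (velScale d c κ τ) z) := by
        unfold avg
        refine StronglyMeasurable.integral_prod_right' (f := fun q : KineticSpace d ×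
          KineticSpace d => f (chart q.1 (timeScale d c τ) (velScale d c κ τ) q.2) * K q.2) ?_
        refine Measurable.stronglyMeasurable ?_
        refine (hfm.comp (Continuous.measurable ?_)).mul
          (hK.1.continuous.measurable.comp measurable_snd)
        exact (continuous_chart_scale d c κ).comp
          (f := fun q : KineticSpace d × KineticSpace d => (τ, q.1, q.2)) (by fun_prop)
      exact (h2.measurable.sub hfm).enorm.mul hk
    rw [← lintegral_add_right _ hmeas]
    refine lintegral_mono fun z => ?_
    dsimp only
    rw [← mul_assoc, ← add_mul]
    gcongr
    have h3 : ‖f z‖ₑ ≤ ‖avg f K (timeScale d c τ) (velScale d c κ τ) z‖ₑ +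
        ‖avg f K (timeScale d c τ) (velScale d c κ τ) z - f z‖ₑ := by
      have := enorm_sub_le (a := avg f K (timeScale d c τ) (velScale d c κ τ) z)
        (b := avg f K (timeScale d c τ) (velScale d c κ τ) z - f z)
      simpa using this
    refine h3.trans ?_
    gcongr
    refine (enorm_avg_le_lintegral hfm hf hfl hK hc hκ.le z τ).trans ?_
    rw [← lintegral_const_mul' _ _ hMt]
    exact lintegral_mono fun τ => hM τ z
  have h2 := (tendsto_lintegral_avg_sub_atBot hfm hf hfl hK hK1 hc hκ hk hk2).const_add
    (M * (∫⁻ z, (∫⁻ τ, scaleDensity G S Q c κ τ z) * k z))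
  rw [add_zero] at h2
  exact ge_of_tendsto' h2 h1

lemma velScale_eq (d : ℕ) {c : ℝ} (hc : 0 < c) (κ τ : ℝ) :
    ENNReal.ofReal (velScale d c κ τ) =
      ENNReal.ofReal ((c ^ (d + 1))⁻¹) * ENNReal.ofReal (Real.exp (κ * τ)) := by
  rw [velScale, ENNReal.ofReal_mul (by positivity)]

lemma timeScale_div_velScale (d : ℕ) {c : ℝ} (hc : 0 < c) (κ τ : ℝ) :
    ENNReal.ofReal (timeScale d c τ / velScale d c κ τ) =
      ENNReal.ofReal (c ^ (3 * d + 1)) * ENNReal.ofReal (Real.exp ((1 - κ) * τ)) := by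
  rw [timeScale, velScale, ← ENNReal.ofReal_mul (by positivity)]
  congr 1
  rw [sub_mul, one_mul, Real.exp_sub]
  field_simp
  ring

lemma lintegral_scaleDensity_mul {G S : KineticSpace d → Rd d} (hG : Measurable G)
    (hS : Measurable S) (Q : Set (KineticSpace d)) {c : ℝ} (hc : 0 < c) (κ : ℝ)
    {k : KineticSpace d → ℝ≥0∞} (hk : Measurable k) :
    ∫⁻ z, (∫⁻ τ, scaleDensity G S Q c κ τ z) * k z =
      ENNReal.ofReal ((c ^ (d + 1))⁻¹) * (∫⁻ τ : ℝ, ENNReal.ofReal (Real.exp (κ * τ)) *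
        ∫⁻ z, k z * ∫⁻ w in Q, ‖G (chart z (timeScale d c τ) (velScale d c κ τ) w)‖ₑ) +
      ENNReal.ofReal (c ^ (3 * d + 1)) * ∫⁻ τ : ℝ, ENNReal.ofReal (Real.exp ((1 - κ) * τ)) *
        ∫⁻ z, k z * ∫⁻ w in Q, ‖S (chart z (timeScale d c τ) (velScale d c κ τ) w)‖ₑ := by
  have hm : ∀ H : KineticSpace d → Rd d, Measurable H → Measurable (fun r : ℝ × KineticSpace d =>
      ∫⁻ w in Q, ‖H (chart r.2 (timeScale d c r.1) (velScale d c κ r.1) w)‖ₑ) := by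
    intro H hH
    refine Measurable.lintegral_prod_right' (f := fun q : (ℝ × KineticSpace d) × KineticSpace d =>
      ‖H (chart q.1.2 (timeScale d c q.1.1) (velScale d c κ q.1.1) q.2)‖ₑ) ?_
    refine (hH.comp (Continuous.measurable ?_)).enorm
    exact (continuous_chart_scale d c κ).comp
      (f := fun q : (ℝ × KineticSpace d) × KineticSpace d => (q.1.1, q.1.2, q.2)) (by fun_prop)
  have hkG : Measurable (fun r : ℝ × KineticSpace d => k r.2 *
      ∫⁻ w in Q, ‖G (chart r.2 (timeScale d c r.1) (velScale d c κ r.1) w)‖ₑ) :=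
    (hk.comp measurable_snd).mul (hm G hG)
  have hkS : Measurable (fun r : ℝ × KineticSpace d => k r.2 *
      ∫⁻ w in Q, ‖S (chart r.2 (timeScale d c r.1) (velScale d c κ r.1) w)‖ₑ) :=
    (hk.comp measurable_snd).mul (hm S hS)
  have ea : ∀ z τ, scaleDensity G S Q c κ τ z * k z =
      ENNReal.ofReal ((c ^ (d + 1))⁻¹) * (ENNReal.ofReal (Real.exp (κ * τ)) *
        (k z * ∫⁻ w in Q, ‖G (chart z (timeScale d c τ) (velScale d c κ τ) w)‖ₑ)) +
      ENNReal.ofReal (c ^ (3 * d + 1)) * (ENNReal.ofReal (Real.exp ((1 - κ) * τ)) *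
        (k z * ∫⁻ w in Q, ‖S (chart z (timeScale d c τ) (velScale d c κ τ) w)‖ₑ)) := by
    intro z τ
    rw [scaleDensity, timeScale_div_velScale d hc, velScale_eq d hc]
    ring
  have hd : Measurable (fun r : ℝ × KineticSpace d => scaleDensity G S Q c κ r.1 r.2) := by
    have h1 := (continuous_timeScale d c).measurable
    have h2 := (continuous_velScale d c κ).measurable
    have h3 := hm G hG
    have h4 := hm S hS
    unfold scaleDensity
    fun_prop
  calc _ = ∫⁻ z, ∫⁻ τ, scaleDensity G S Q c κ τ z * k z := by
        refine lintegral_congr fun z => ?_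
        exact (lintegral_mul_const _ (hd.comp (measurable_prodMk_right (y := z)))).symm
    _ = ∫⁻ τ, ∫⁻ z, scaleDensity G S Q c κ τ z * k z := by
        rw [lintegral_lintegral_swap]
        exact ((hd.comp measurable_swap).mul (hk.comp measurable_fst)).aemeasurable
    _ = _ := by
        simp only [ea]
        rw [← lintegral_const_mul' _ _ ENNReal.ofReal_ne_top,
          ← lintegral_const_mul' _ _ ENNReal.ofReal_ne_top, ← lintegral_add_left]
        · refine lintegral_congr fun τ => ?_
          have hg := hkG.comp (measurable_prodMk_left (x := τ))
          have hs := hkS.comp (measurable_prodMk_left (x := τ))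
          simp only [Function.comp_def] at hg hs
          rw [lintegral_add_left (by fun_prop), lintegral_const_mul' _ _ ENNReal.ofReal_ne_top,
            lintegral_const_mul' _ _ ENNReal.ofReal_ne_top,
            lintegral_const_mul' _ _ ENNReal.ofReal_ne_top,
            lintegral_const_mul' _ _ ENNReal.ofReal_ne_top]
        · have := Measurable.lintegral_prod_right' (ν := (volume : Measure (KineticSpace d))) hkG
          fun_prop

lemma min_rpow_le {x y : ℝ≥0∞} {r : ℝ} (hr : 2 ≤ r) :
    min x y ^ r ≤ y ^ (r - 2) * x ^ (2 : ℝ) := by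
  calc min x y ^ r = min x y ^ (r - 2) * min x y ^ (2 : ℝ) := by
        rw [← ENNReal.rpow_add_of_nonneg _ _ (by linarith) (by norm_num)]; congr 1; ring
    _ ≤ _ := mul_le_mul' (ENNReal.rpow_le_rpow (min_le_right _ _) (by linarith))
        (ENNReal.rpow_le_rpow (min_le_left _ _) (by norm_num))

/-- Duality between `L^q` and `L^{q'}`. The truncations of `f ^ (q - 1)` are admissible test functions
because `f ∈ L^2` and `q > 2`, and they recover the `L^q` norm without assuming that it is finite. -/
lemma lintegral_rpow_le_of_pairing_le {Z : Type*} [MeasurableSpace Z] {ν : Measure Z} {q : ℝ}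
    (hq : 2 < q) {f : Z → ℝ≥0∞} (hf : Measurable f) (hft : ∀ z, f z ≠ ⊤)
    (hf2 : ∫⁻ z, f z ^ (2 : ℝ) ∂ν ≠ ⊤) {R : ℝ≥0∞}
    (h : ∀ k : Z → ℝ≥0∞, Measurable k → (∀ z, k z ≠ ⊤) → ∫⁻ z, k z ^ (2 : ℝ) ∂ν ≠ ⊤ →
      ∀ B : ℝ≥0∞, B ≠ 0 → B ≠ ⊤ → ∫⁻ z, k z ^ (q / (q - 1)) ∂ν ≤ B ^ (q / (q - 1)) →
      ∫⁻ z, f z * k z ∂ν ≤ R * B) :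
    ∫⁻ z, f z ^ q ∂ν ≤ R ^ q := by
  have hq0 : 0 < q := by linarith
  have hq1 : 0 < q - 1 := by linarith
  have hn : ∀ n : ℕ, ∫⁻ z, min (f z) n ^ q ∂ν ≤ R ^ q := by
    intro n
    set I := ∫⁻ z, min (f z) n ^ q ∂ν with hI
    have hfin : ∀ r : ℝ, 2 ≤ r → ∫⁻ z, min (f z) n ^ r ∂ν ≠ ⊤ := by
      intro r hr
      refine ne_top_of_le_ne_top ?_ (lintegral_mono fun z => min_rpow_le hr)
      rw [lintegral_const_mul _ (by fun_prop)]
      exact ENNReal.mul_ne_top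
        (ENNReal.rpow_ne_top_of_nonneg (by linarith) (ENNReal.natCast_ne_top n)) hf2
    rcases eq_or_ne I 0 with h0 | h0
    · rw [h0]; exact zero_le
    have hIt : I ≠ ⊤ := hfin q hq.le
    have hB := h (fun z => min (f z) n ^ (q - 1)) (by fun_prop)
      (fun z => ENNReal.rpow_ne_top_of_nonneg hq1.le (ne_top_of_le_ne_top (hft z) (min_le_left _ _)))
      (by
        simp only [← ENNReal.rpow_mul]
        exact hfin _ (by linarith))
      (I ^ ((q - 1) / q)) (by simp [h0, hIt])
      (ENNReal.rpow_ne_top_of_nonneg (by positivity) hIt)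
      (by
        simp only [← ENNReal.rpow_mul]
        rw [show (q - 1) * (q / (q - 1)) = q by field_simp,
          show (q - 1) / q * (q / (q - 1)) = 1 by field_simp, ENNReal.rpow_one])
    have hle : I ≤ R * I ^ ((q - 1) / q) := by
      refine le_trans ?_ hB
      refine lintegral_mono fun z => ?_
      calc min (f z) n ^ q = min (f z) n ^ (1 : ℝ) * min (f z) n ^ (q - 1) := by
            rw [← ENNReal.rpow_add_of_nonneg _ _ (by norm_num) hq1.le]; congr 1; ring
        _ ≤ _ := by
            rw [ENNReal.rpow_one]
            gcongr
            exact min_le_left _ _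
    have hle2 : I ^ (1 / q) ≤ R := by
      have e : I ^ (1 / q) * I ^ ((q - 1) / q) = I := by
        rw [← ENNReal.rpow_add_of_nonneg _ _ (by positivity) (by positivity),
          show 1 / q + (q - 1) / q = 1 by field_simp; ring, ENNReal.rpow_one]
      refine (ENNReal.mul_le_mul_iff_left (c := I ^ ((q - 1) / q)) (by simp [h0, hIt])
        (ENNReal.rpow_ne_top_of_nonneg (by positivity) hIt)).1 ?_
      rwa [e]
    calc I = (I ^ (1 / q)) ^ q := by
          rw [← ENNReal.rpow_mul, one_div_mul_cancel hq0.ne', ENNReal.rpow_one]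
      _ ≤ R ^ q := by gcongr
  have hlim := lintegral_tendsto_of_tendsto_of_monotone (μ := ν)
    (f := fun (n : ℕ) z => min (f z) n ^ q) (F := fun z => f z ^ q)
    (fun n => by fun_prop)
    (.of_forall fun z n m hnm => by
      dsimp only
      gcongr)
    (.of_forall fun z => by
      obtain ⟨n, hn⟩ := ENNReal.exists_nat_gt (hft z)
      refine tendsto_const_nhds.congr' ?_
      filter_upwards [Filter.eventually_ge_atTop n] with m hm
      rw [min_eq_left (hn.le.trans (by exact_mod_cast hm))])
  exact le_of_tendsto' hlim hn

/-! ### The additive and the multiplicative inequality -/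

lemma eLpNorm_le_iff_lintegral_rpow_enorm_le {Z E : Type*} [MeasurableSpace Z] {ν : Measure Z}
    [NormedAddCommGroup E] {g : Z → E} {p : ℝ} {R : ℝ≥0∞} (hp : 0 < p) :
    eLpNorm g (ENNReal.ofReal p) ν ≤ R ↔ ∫⁻ z, ‖g z‖ₑ ^ p ∂ν ≤ R ^ p := by
  rw [eLpNorm_eq_lintegral_rpow_enorm_toReal (by simpa using hp) ENNReal.ofReal_ne_top,
    ENNReal.toReal_ofReal hp.le, one_div, ENNReal.rpow_inv_le_iff hp]

/-- The additive inequality, for every anisotropic scaling parameter `c`. The exponent `κ` of the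
velocity scale is chosen such that the two terms, which are potentials of orders `κ` and `1 - κ`,
both map into `L^q`. -/
theorem exists_eLpNorm_le_add (d : ℕ) {p μ q : ℝ} (hp : 1 < p) (hμ : 1 < μ)
    (hq : 1 / q = 1 / (4 * (d : ℝ) + 2) *
      ((3 * (d : ℝ) + 1) / p + ((d : ℝ) + 1) / μ - 1))
    (hq2 : 2 < q) (hpq : p < q) (hμq : μ < q) :
    ∃ C : ℝ≥0∞, C ≠ ⊤ ∧ ∀ (f : KineticSpace d → ℝ) (G S : KineticSpace d → Rd d), Measurable f →
      Measurable G → Measurable S → MemLp f 2 → HasWeakGradV f G → IsKineticSolution f S →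
      ∀ A B c : ℝ, 0 < A → 0 < B → 0 < c → eLpNorm G (ENNReal.ofReal p) volume ≤ ENNReal.ofReal A →
        eLpNorm S (ENNReal.ofReal μ) volume ≤ ENNReal.ofReal B →
        eLpNorm f (ENNReal.ofReal q) volume ≤
          C * ENNReal.ofReal ((c ^ (d + 1))⁻¹ * A + c ^ (3 * d + 1) * B) := by
  have hp0 : 0 < p := by linarith
  have hμ0 : 0 < μ := by linarith
  have hq0 : 0 < q := by linarith
  set δ : ℝ := 1 / p - 1 / q with hδ
  set δ' : ℝ := 1 / μ - 1 / q with hδ'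
  have hδ0 : 0 < δ := sub_pos.2 (one_div_lt_one_div_of_lt hp0 hpq)
  have hδ'0 : 0 < δ' := sub_pos.2 (one_div_lt_one_div_of_lt hμ0 hμq)
  have hrel : (3 * (d : ℝ) + 1) * δ + (d + 1) * δ' = 1 := by
    have h1 : (4 * (d : ℝ) + 2) * (1 / q) = (3 * d + 1) * (1 / p) + (d + 1) * (1 / μ) - 1 := by
      rw [hq]; field_simp
    rw [hδ, hδ']; linarith
  set κ : ℝ := δ / (δ + δ') with hκ
  have hκ0 : 0 < κ := by positivity
  have hκ' : 1 - κ = δ' / (δ + δ') := by rw [hκ]; field_simp; ring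
  have hκ1 : 0 < 1 - κ := by rw [hκ']; positivity
  have hN : 1 + (d : ℝ) + 2 * d * κ = 1 / (δ + δ') := by
    rw [hκ]; field_simp; linarith
  have hκN : κ / (1 + (d : ℝ) + 2 * d * κ) = δ := by rw [hN, hκ]; field_simp
  have hκN' : (1 - κ) / (1 + (d : ℝ) + 2 * d * κ) = δ' := by rw [hN, hκ']; field_simp
  set s : ℝ := q / (q - 1) with hs
  have hs1 : 1 < s := by rw [hs, one_lt_div (by linarith)]; linarith
  have hsi : 1 / s = 1 - 1 / q := by rw [hs]; field_simp
  obtain ⟨K, hK, hK1⟩ := exists_bump d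
  obtain ⟨Q, M, hQ, hMt, hM⟩ := exists_enorm_avg_dilGen_le κ hK
  have hQf : volume Q ≠ ⊤ := hQ.measure_lt_top.ne
  obtain ⟨C₁, hC₁, H₁⟩ := exists_form_le d hκ0.le hκ0 hp hs1 (by rw [hκN, hsi, hδ]; ring) hQf
  obtain ⟨C₂, hC₂, H₂⟩ := exists_form_le d hκ0.le hκ1 hμ hs1 (by rw [hκN', hsi, hδ']; ring) hQf
  refine ⟨M * (C₁ + C₂), ENNReal.mul_ne_top hMt (ENNReal.add_ne_top.2 ⟨hC₁, hC₂⟩), ?_⟩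
  intro f G S hfm hGm hSm hf hG hS A B c hA hB hc hGA hSB
  have hf2 : ∫⁻ y, ‖f y‖ₑ ^ (2 : ℝ) ≠ ⊤ := by
    have := lintegral_rpow_enorm_lt_top_of_eLpNorm_lt_top two_ne_zero ENNReal.ofNat_ne_top hf.2
    simpa using this.ne
  refine (eLpNorm_le_iff_lintegral_rpow_enorm_le hq0).2 (lintegral_rpow_le_of_pairing_le hq2 hfm.enorm
    (fun z => enorm_ne_top) hf2 ?_)
  intro k hk hkt hk2 D hD0 hDt hkD
  refine (lintegral_enorm_mul_le hfm hf hG.1 hK hK1 hκ0 hMt hc (hM f G S hG hS c hc) hk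
    hk2).trans ?_
  rw [lintegral_scaleDensity_mul hGm hSm Q hc κ hk]
  have B₁ := H₁ c hc (fun z => ‖G z‖ₑ) k hGm.enorm hk (fun _ => enorm_ne_top) hkt
    (ENNReal.ofReal A) D (by simpa using hA) ENNReal.ofReal_ne_top hD0 hDt
    ((eLpNorm_le_iff_lintegral_rpow_enorm_le hp0).1 hGA) hkD
  have B₂ := H₂ c hc (fun z => ‖S z‖ₑ) k hSm.enorm hk (fun _ => enorm_ne_top) hkt
    (ENNReal.ofReal B) D (by simpa using hB) ENNReal.ofReal_ne_top hD0 hDt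
    ((eLpNorm_le_iff_lintegral_rpow_enorm_le hμ0).1 hSB) hkD
  rw [ENNReal.ofReal_add (by positivity) (by positivity), ENNReal.ofReal_mul (by positivity),
    ENNReal.ofReal_mul (by positivity)]
  calc _ ≤ M * (ENNReal.ofReal ((c ^ (d + 1))⁻¹) * ((C₁ + C₂) * ENNReal.ofReal A * D) +
        ENNReal.ofReal (c ^ (3 * d + 1)) * ((C₁ + C₂) * ENNReal.ofReal B * D)) := by
        gcongr
        · refine B₁.trans ?_
          gcongr
          exact le_self_add
        · refine B₂.trans ?_
          gcongr
          exact le_add_self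
    _ = _ := by ring

lemma exists_optimal_scale (d : ℕ) {A B : ℝ} (hA : 0 < A) (hB : 0 < B) :
    ∃ c : ℝ, 0 < c ∧ (c ^ (d + 1))⁻¹ * A + c ^ (3 * d + 1) * B =
      2 * (A ^ ((3 * (d : ℝ) + 1) / (4 * (d : ℝ) + 2)) *
        B ^ (((d : ℝ) + 1) / (4 * (d : ℝ) + 2))) := by
  refine ⟨(A / B) ^ (1 / (4 * (d : ℝ) + 2)), by positivity, ?_⟩
  have hD : (4 * (d : ℝ) + 2) ≠ 0 := by positivity
  rw [← Real.rpow_natCast, ← Real.rpow_natCast, ← Real.rpow_mul (by positivity),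
    ← Real.rpow_mul (by positivity), ← Real.rpow_neg (by positivity),
    Real.div_rpow hA.le hB.le, Real.div_rpow hA.le hB.le]
  set θ : ℝ := ((d : ℝ) + 1) / (4 * (d : ℝ) + 2) with hθ
  have e1 : 1 / (4 * (d : ℝ) + 2) * ((d + 1 : ℕ) : ℝ) = θ := by
    rw [hθ]; push_cast; field_simp
  have e2 : 1 / (4 * (d : ℝ) + 2) * ((3 * d + 1 : ℕ) : ℝ) = 1 - θ := by
    rw [hθ]; push_cast; field_simp; ring
  have e3 : (3 * (d : ℝ) + 1) / (4 * (d : ℝ) + 2) = 1 - θ := by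
    rw [hθ]; field_simp; ring
  rw [e1, e2, e3, Real.rpow_neg hA.le, Real.rpow_neg hB.le, Real.rpow_sub hA, Real.rpow_sub hB,
    Real.rpow_one, Real.rpow_one]
  have := Real.rpow_pos_of_pos hA θ
  have := Real.rpow_pos_of_pos hB θ
  field_simp
  ring

lemma hasWeakGradV_congr {f f' : KineticSpace d → ℝ} {G G' : KineticSpace d → Rd d}
    (h : HasWeakGradV f G) (hf : f =ᵐ[volume] f') (hG : G =ᵐ[volume] G') :
    HasWeakGradV f' G' := by
  refine ⟨h.1.congr hf, h.2.1.congr hG, fun φ hφ i => ?_⟩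
  have h1 : ∫ z, f' z * partialV i φ z = ∫ z, f z * partialV i φ z :=
    integral_congr_ae (by filter_upwards [hf] with z hz; rw [hz])
  have h2 : ∫ z, G' z i * φ z = ∫ z, G z i * φ z :=
    integral_congr_ae (by filter_upwards [hG] with z hz; rw [hz])
  rw [h1, h2, h.2.2 φ hφ i]

lemma isKineticSolution_congr {f f' : KineticSpace d → ℝ} {S S' : KineticSpace d → Rd d}
    (h : IsKineticSolution f S) (hf : f =ᵐ[volume] f') (hS : S =ᵐ[volume] S') :
    IsKineticSolution f' S' := by
  refine ⟨h.1.congr hf, h.2.1.congr hS, fun φ hφ => ?_⟩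
  have h1 : ∫ z, f' z * transport φ z = ∫ z, f z * transport φ z :=
    integral_congr_ae (by filter_upwards [hf] with z hz; rw [hz])
  have h2 : ∫ z, ∑ i : Fin d, S' z i * partialV i φ z = ∫ z, ∑ i : Fin d, S z i * partialV i φ z :=
    integral_congr_ae (by filter_upwards [hS] with z hz; rw [hz])
  rw [h1, h2, h.2.2 φ hφ]

end Kinetic

open Kinetic

theorem theorem1p2 (d : ℕ) (hd : 1 ≤ d) (p μ q : ℝ) (hp : 1 < p) (hμ : 1 < μ)
    (hq : 1 / q = 1 / (4 * (d : ℝ) + 2) *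
      ((3 * (d : ℝ) + 1) / p + ((d : ℝ) + 1) / μ - 1))
    (hq' : max 2 (max p μ) < q) :
    ∃ C : ℝ, 0 < C ∧
      ∀ (f : KineticSpace d → ℝ) (G S₀ : KineticSpace d → Rd d),
        MemLp f 2 volume →
        HasWeakGradV f G →
        MemLp G (ENNReal.ofReal p) volume →
        MemLp S₀ (ENNReal.ofReal μ) volume →
        IsKineticSolution f S₀ →
        eLpNorm f (ENNReal.ofReal q) volume ≤
          ENNReal.ofReal C *
            eLpNorm G (ENNReal.ofReal p) volume ^ ((3 * (d : ℝ) + 1) / (4 * (d : ℝ) + 2)) *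
            eLpNorm S₀ (ENNReal.ofReal μ) volume ^ (((d : ℝ) + 1) / (4 * (d : ℝ) + 2)) := by
  obtain ⟨hq2, hpq, hμq⟩ : 2 < q ∧ p < q ∧ μ < q := by
    simpa [max_lt_iff] using hq'
  obtain ⟨C, hC, H⟩ := exists_eLpNorm_le_add d hp hμ hq hq2 hpq hμq
  refine ⟨2 * C.toReal + 1, by positivity, ?_⟩
  intro f G S hf hG hGp hSμ hS
  have hmain : ∀ A B : ℝ, 0 < A → 0 < B → eLpNorm G (ENNReal.ofReal p) volume ≤ ENNReal.ofReal A →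
      eLpNorm S (ENNReal.ofReal μ) volume ≤ ENNReal.ofReal B →
      eLpNorm f (ENNReal.ofReal q) volume ≤ ENNReal.ofReal (2 * C.toReal + 1) *
        ENNReal.ofReal (A ^ ((3 * (d : ℝ) + 1) / (4 * (d : ℝ) + 2)) *
          B ^ (((d : ℝ) + 1) / (4 * (d : ℝ) + 2))) := by
    intro A B hA hB hGA hSB
    obtain ⟨c, hc, hcAB⟩ := exists_optimal_scale d hA hB
    have ef := hf.1.ae_eq_mk
    have eG := hGp.1.ae_eq_mk
    have eS := hSμ.1.ae_eq_mk
    have h := H (hf.1.mk f) (hGp.1.mk G) (hSμ.1.mk S) hf.1.stronglyMeasurable_mk.measurable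
      hGp.1.stronglyMeasurable_mk.measurable hSμ.1.stronglyMeasurable_mk.measurable
      ((memLp_congr_ae ef).1 hf) (hasWeakGradV_congr hG ef eG) (isKineticSolution_congr hS ef eS)
      A B c hA hB hc (by rwa [← eLpNorm_congr_ae eG]) (by rwa [← eLpNorm_congr_ae eS])
    rw [← eLpNorm_congr_ae ef, hcAB] at h
    refine h.trans ?_
    rw [ENNReal.ofReal_mul zero_le_two, ← mul_assoc]
    gcongr
    rw [← ENNReal.ofReal_toReal hC, ENNReal.toReal_ofReal ENNReal.toReal_nonneg,
      ← ENNReal.ofReal_mul ENNReal.toReal_nonneg]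
    exact ENNReal.ofReal_le_ofReal (by linarith)
  set θ₁ : ℝ := (3 * (d : ℝ) + 1) / (4 * (d : ℝ) + 2) with hθ₁
  set θ₂ : ℝ := ((d : ℝ) + 1) / (4 * (d : ℝ) + 2) with hθ₂
  have hθ₁0 : 0 < θ₁ := by positivity
  have hθ₂0 : 0 < θ₂ := by positivity
  -- the norms may vanish, so they are approximated from above by positive numbers
  set a : ℝ := (eLpNorm G (ENNReal.ofReal p) volume).toReal with ha
  set b : ℝ := (eLpNorm S (ENNReal.ofReal μ) volume).toReal with hb
  have hGa : eLpNorm G (ENNReal.ofReal p) volume = ENNReal.ofReal a :=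
    (ENNReal.ofReal_toReal hGp.2.ne).symm
  have hSb : eLpNorm S (ENNReal.ofReal μ) volume = ENNReal.ofReal b :=
    (ENNReal.ofReal_toReal hSμ.2.ne).symm
  have ha0 : 0 ≤ a := ENNReal.toReal_nonneg
  have hb0 : 0 ≤ b := ENNReal.toReal_nonneg
  have hlim : Filter.Tendsto (fun ε : ℝ => ENNReal.ofReal (2 * C.toReal + 1) *
      ENNReal.ofReal ((a + ε) ^ θ₁ * (b + ε) ^ θ₂)) (nhdsWithin 0 (Set.Ioi 0))
      (nhds (ENNReal.ofReal (2 * C.toReal + 1) * ENNReal.ofReal (a ^ θ₁ * b ^ θ₂))) := by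
    refine ENNReal.Tendsto.const_mul (ENNReal.tendsto_ofReal ?_) (Or.inr ENNReal.ofReal_ne_top)
    have hcont : Continuous fun ε : ℝ => (a + ε) ^ θ₁ * (b + ε) ^ θ₂ :=
      ((continuous_const.add continuous_id).rpow_const fun _ => Or.inr hθ₁0.le).mul
        ((continuous_const.add continuous_id).rpow_const fun _ => Or.inr hθ₂0.le)
    have := hcont.tendsto 0
    simp only [add_zero] at this
    exact this.mono_left nhdsWithin_le_nhds
  rw [hGa, hSb, mul_assoc, ENNReal.ofReal_rpow_of_nonneg ha0 hθ₁0.le,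
    ENNReal.ofReal_rpow_of_nonneg hb0 hθ₂0.le, ← ENNReal.ofReal_mul (by positivity)]
  refine ge_of_tendsto hlim ?_
  filter_upwards [self_mem_nhdsWithin] with ε hε
  have hε0 : 0 < ε := hε
  refine hmain (a + ε) (b + ε) (by positivity) (by positivity) ?_ ?_
  · rw [hGa]; exact ENNReal.ofReal_le_ofReal (by linarith)
  · rw [hSb]; exact ENNReal.ofReal_le_ofReal (by linarith)
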